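/- Let $\mathbf{k}$ be a field, and let $H_i(-)$ denote singular homology with coefficients in $\mathbf{k}$ ($i\in\mathbb{Z}$, with $H_i=0$ for $i<0$). Let $\Delta^+=\{(x_1,x_2)\in\mathbb{R}^2 : x_1+x_2>0\}$ with the product order. A persistence module over $\Delta^+$ is a functor $M$ from the poset $\Delta^+$ to $\mathbf{k}$-vector spaces; for $s\in\mathbb{R}^2_{\ge 0}$, $M[s]$ denotes the persistence module $x\mapsto M(x+s)$. For $s=(s_1,s_2)\in\mathbb{R}^2_{>0}$ put $s_x=(s_1,0)$ and $s_y=(0,s_2)$. A Mayer–Vietoris system over $\mathbb{R}$ is a collection $(S_i,\delta_i^s)_{i\in\mathbb{Z},\,s\in\mathbb{R}^2_{>0}}$ of persistence modules $S_i$ over $\Delta^+$ and morphisms $\delta_i^s:S_i[s]\to S_{i-1}$ such that for all $i$ and $s$ the sequence $$S_{i+1}[s]\xrightarrow{\ \delta_{i+1}^s\ }S_i\longrightarrow S_i[s_x]\oplus S_i[s_y]\longrightarrow S_i[s]\xrightarrow{\ \delta_i^s\ }S_{i-1}$$ is exact (the second map is $v\mapsto(v,-v)$ and the third is $(v,w)\mapsto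 v+w$, up to structural morphisms), and such that for $s\le s'$ the composite $S_i[s]\to S_i[s']\xrightarrow{\delta_i^{s'}}S_{i-1}$ equals $\delta_i^s$. A morphism $(S_i,\delta_i^s)\to(T_i,\tilde\delta_i^s)$ is a family of morphisms of persistence modules $\varphi_i:S_i\to T_i$ with $\tilde\delta_i^s\circ\varphi_i[s]=\varphi_{i-1}\circ\delta_i^s$ for all $i$ and $s$. This defines the category $\mathrm{M\text{-}V}(\mathbb{R})$. Let $\mathrm{Top}_{|\mathbb{R}}$ be the category whose objects are the continuous functions $h:X\to\mathbb{R}$ on topological spaces and whose morphisms from $f:X\to\mathbb{R}$ to $g:Y\to\mathbb{R}$ are the continuous maps $\phi:X\to Y$ with $g\circ\phi=f$. For $h:X\to\mathbb{R}$ in $\mathrm{Top}_{|\mathbb{R}}$ let $M_i^h$ be the persistence module $x=(x_1,x_2)\mapsto H_i\big(h^{-1}(]-x_1,x_2[)\big)$, with structural morphisms induced by inclusions. For $s\in\mathbb{R}^2_{>0}$ and $x\in\Delta^+$, the open set $h^{-1}(]-x_1-s_1,x_2+s_2[)$ is covered by the open sets $h^{-1}(]-x_1-s_1,x_2[)$ and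 $h^{-1}(]-x_1,x_2+s_2[)$, whose intersection is $h^{-1}(]-x_1,x_2[)$. Let $\delta_i^{s,x}:M_i^h(x+s)\to M_{i-1}^h(x)$ be the connecting homomorphism of the Mayer–Vietoris sequence of this cover for $i\ge 1$, and $\delta_i^{s,x}=0$ for $i\le 0$. **Proposition.** The Mayer–Vietoris connecting homomorphisms $\delta_i^{s,x}$ are well defined, that is, for each of these covers the inclusion of the complex of sums of singular chains of the two covering sets into the singular chain complex of their union is a quasi-isomorphism. For every $h$, the maps $\delta_i^{s,x}$, $x\in\Delta^+$, form morphisms of persistence modules $\delta_i^s:M_i^h[s]\to M_{i-1}^h$, and $M^h=(M_i^h,\delta_i^s)_{i\in\mathbb{Z},\,s\in\mathbb{R}^2_{>0}}$ is a Mayer–Vietoris system over $\mathbb{R}$. Moreover, for every morphism $\phi$ from $f$ to $g$ in $\mathrm{Top}_{|\mathbb{R}}$, the maps $\phi_*:H_i\big(f^{-1}(]-x_1,x_2[)\big)\to H_i\big(g^{-1}(]-x_1,x_2[)\big)$ form a morphism $M^f\to M^g$ of Mayer–Vietoris systems, and $f\mapsto M^f$, $\phi\mapsto\phi_*$ is a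 functor $\mathrm{Top}_{|\mathbb{R}}\to\mathrm{M\text{-}V}(\mathbb{R})$. -/

import Mathlib

open CategoryTheory CategoryTheory.Limits
open scoped NNReal

universe u v w

namespace MayerVietoris

noncomputable section

/-! ### Persistence modules over `Δ⁺` -/

/-- The poset `Δ⁺ = {(x₁, x₂) ∈ ℝ² | x₁ + x₂ > 0}` with the product order. -/
abbrev DeltaPlus : Type := {x : ℝ × ℝ // 0 < x.1 + x.2}

/-- The translate `x + s` of a point `x` of `Δ⁺` by a vector `s` with nonnegative coordinates. -/
def DeltaPlus.add (x : DeltaPlus) (s : ℝ≥0 × ℝ≥0) : DeltaPlus :=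
  ⟨(x.1.1 + s.1, x.1.2 + s.2), by
    have h := x.2
    have h1 := s.1.coe_nonneg
    have h2 := s.2.coe_nonneg
    dsimp only
    linarith⟩

lemma DeltaPlus.add_mono {x y : DeltaPlus} {s t : ℝ≥0 × ℝ≥0} (hxy : x ≤ y) (hst : s ≤ t) :
    x.add s ≤ y.add t :=
  ⟨add_le_add hxy.1 (NNReal.coe_le_coe.2 hst.1), add_le_add hxy.2 (NNReal.coe_le_coe.2 hst.2)⟩

lemma DeltaPlus.le_add (x : DeltaPlus) (s : ℝ≥0 × ℝ≥0) : x ≤ x.add s :=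
  ⟨le_add_of_nonneg_right s.1.coe_nonneg, le_add_of_nonneg_right s.2.coe_nonneg⟩

/-- The vectors `s = (s₁, s₂)` with `s₁ > 0` and `s₂ > 0`. -/
abbrev PosVec : Type := {s : ℝ≥0 × ℝ≥0 // 0 < s.1 ∧ 0 < s.2}

/-- `s_x = (s₁, 0)`. -/
def PosVec.sx (s : PosVec) : ℝ≥0 × ℝ≥0 := (s.1.1, 0)

/-- `s_y = (0, s₂)`. -/
def PosVec.sy (s : PosVec) : ℝ≥0 × ℝ≥0 := (0, s.1.2)

lemma PosVec.sx_le (s : PosVec) : s.sx ≤ s.1 := ⟨le_rfl, zero_le⟩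

lemma PosVec.sy_le (s : PosVec) : s.sy ≤ s.1 := ⟨zero_le, le_rfl⟩

/-- The category `Pers(Δ⁺)` of persistence modules over `Δ⁺`. -/
abbrev Pers (k : Type u) [Field k] : Type _ := DeltaPlus ⥤ ModuleCat.{v} k

/-- The translation functor `x ↦ x + s` of the poset `Δ⁺`. -/
def translate (s : ℝ≥0 × ℝ≥0) : DeltaPlus ⥤ DeltaPlus :=
  Monotone.functor (f := fun x => x.add s) (fun _ _ h => DeltaPlus.add_mono h le_rfl)

section Systems

variable {k : Type u} [Field k]

/-- The shifted persistence module `M[s]`, `M[s](x) = M(x + s)`. -/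
abbrev shift (s : ℝ≥0 × ℝ≥0) (M : Pers.{u, v} k) : Pers.{u, v} k := translate s ⋙ M

/-- The structural morphism `M[s] ⟶ M[t]` for `s ≤ t`. -/
def shiftTrans (M : Pers.{u, v} k) {s t : ℝ≥0 × ℝ≥0} (h : s ≤ t) : shift s M ⟶ shift t M where
  app x := M.map (homOfLE (DeltaPlus.add_mono (le_refl x) h))
  naturality x y f := by
    dsimp [shift]
    rw [← M.map_comp, ← M.map_comp]
    rfl

/-- At the point `x`, the map `M ⟶ M[s_x] ⊕ M[s_y]` with components `(τ_{s_x}, -τ_{s_y})`. -/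
def toShifts (M : Pers.{u, v} k) (s : PosVec) (x : DeltaPlus) :
    M.obj x →ₗ[k] M.obj (x.add s.sx) × M.obj (x.add s.sy) :=
  LinearMap.prod (M.map (homOfLE (x.le_add s.sx))).hom (-(M.map (homOfLE (x.le_add s.sy))).hom)

/-- At the point `x`, the map `M[s_x] ⊕ M[s_y] ⟶ M[s]`, `(v, w) ↦ τ_{s_y} v + τ_{s_x} w`. -/
def fromShifts (M : Pers.{u, v} k) (s : PosVec) (x : DeltaPlus) :
    M.obj (x.add s.sx) × M.obj (x.add s.sy) →ₗ[k] M.obj (x.add s.1) :=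
  LinearMap.coprod
    (M.map (homOfLE (DeltaPlus.add_mono (le_refl x) s.sx_le))).hom
    (M.map (homOfLE (DeltaPlus.add_mono (le_refl x) s.sy_le))).hom

/-- The axioms of a Mayer-Vietoris persistence system. The family is indexed so that `δ i s` is
the connecting morphism `S_{i+1}[s] ⟶ S_i`, usually written `δ_{i+1}^s`; `i` runs through `ℤ`.
Exactness of sequences of persistence modules is exactness at every point of `Δ⁺`. -/
structure IsMVSystem (S : ℤ → Pers.{u, v} k)
    (δ : ∀ (i : ℤ) (s : PosVec), shift s.1 (S (i + 1)) ⟶ S i) : Prop where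
  /-- Exactness of `S_{i+1}[s] ⟶ S_i ⟶ S_i[s_x] ⊕ S_i[s_y]`. -/
  exact_left (i : ℤ) (s : PosVec) (x : DeltaPlus) :
    Function.Exact ((δ i s).app x).hom (toShifts (S i) s x)
  /-- Exactness of `S_i ⟶ S_i[s_x] ⊕ S_i[s_y] ⟶ S_i[s]`. -/
  exact_middle (i : ℤ) (s : PosVec) (x : DeltaPlus) :
    Function.Exact (toShifts (S i) s x) (fromShifts (S i) s x)
  /-- Exactness of `S_{i+1}[s_x] ⊕ S_{i+1}[s_y] ⟶ S_{i+1}[s] ⟶ S_i`. -/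
  exact_right (i : ℤ) (s : PosVec) (x : DeltaPlus) :
    Function.Exact (fromShifts (S (i + 1)) s x) ((δ i s).app x).hom
  /-- For `s ≤ s'`, the morphism `δ^s` is `S_{i+1}[s] ⟶ S_{i+1}[s']` followed by `δ^{s'}`. -/
  comm (i : ℤ) (s s' : PosVec) (h : s ≤ s') :
    shiftTrans (S (i + 1)) (show s.1 ≤ s'.1 from h) ≫ δ i s' = δ i s

/-- A family of morphisms `φ_i : S_i ⟶ T_i` commutes with the connecting morphisms. -/
def IsMVHom {S T : ℤ → Pers.{u, v} k}
    (δ : ∀ (i : ℤ) (s : PosVec), shift s.1 (S (i + 1)) ⟶ S i)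
    (δ' : ∀ (i : ℤ) (s : PosVec), shift s.1 (T (i + 1)) ⟶ T i)
    (φ : ∀ i : ℤ, S i ⟶ T i) : Prop :=
  ∀ (i : ℤ) (s : PosVec),
    Functor.whiskerLeft (translate s.1) (φ (i + 1)) ≫ δ' i s = δ i s ≫ φ i

end Systems

/-- Mayer-Vietoris persistence systems over `ℝ`. -/
structure MVSystem (k : Type u) [Field k] where
  /-- The persistence module in degree `i`. -/
  S : ℤ → Pers.{u, v} k
  /-- The connecting morphism `S_{i+1}[s] ⟶ S_i`. -/
  δ : ∀ (i : ℤ) (s : PosVec), shift s.1 (S (i + 1)) ⟶ S i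
  isMV : IsMVSystem S δ

/-- Morphisms of Mayer-Vietoris persistence systems. -/
@[ext]
structure MVSystem.Hom {k : Type u} [Field k] (S T : MVSystem.{u, v} k) where
  /-- The component in degree `i`. -/
  app : ∀ i : ℤ, S.S i ⟶ T.S i
  isMVHom : IsMVHom S.δ T.δ app

/-- The category `M-V(ℝ)`. -/
instance (k : Type u) [Field k] : Category (MVSystem.{u, v} k) where
  Hom := MVSystem.Hom
  id S := ⟨fun i => 𝟙 (S.S i), fun i s => by simp⟩
  comp f g := ⟨fun i => f.app i ≫ g.app i, fun i s => by
    have h1 := f.isMVHom i s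
    have h2 := g.isMVHom i s
    rw [Functor.whiskerLeft_comp, Category.assoc, h2, ← Category.assoc, h1, Category.assoc]⟩
  id_comp f := MVSystem.Hom.ext (funext fun i => Category.id_comp _)
  comp_id f := MVSystem.Hom.ext (funext fun i => Category.comp_id _)
  assoc f g h := MVSystem.Hom.ext (funext fun i => Category.assoc _ _ _)

/-! ### Topological spaces over `ℝ` -/

/-- A topological space with a continuous real-valued function. -/
structure TopOverReal where
  /-- The space. -/
  X : TopCat.{w}
  /-- The function. -/
  fn : C(X, ℝ)

/-- A continuous map `φ : X ⟶ Y` such that `g ∘ φ = f`. -/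
@[ext]
structure TopOverReal.Hom (f g : TopOverReal.{w}) where
  /-- The continuous map. -/
  map : C(f.X, g.X)
  comm : ∀ p : f.X, g.fn (map p) = f.fn p

/-- The category of topological spaces over `ℝ`. -/
instance : Category TopOverReal.{w} where
  Hom := TopOverReal.Hom
  id f := ⟨ContinuousMap.id _, fun _ => rfl⟩
  comp φ ψ := ⟨ψ.map.comp φ.map, fun p => (ψ.comm (φ.map p)).trans (φ.comm p)⟩

/-! ### Singular homology and the Mayer-Vietoris connecting homomorphism -/

/-- Inclusion of subspaces of a topological space, as a morphism of topological spaces. -/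
def inclusion {X : TopCat.{w}} {A B : Set X} (h : A ⊆ B) : TopCat.of A ⟶ TopCat.of B :=
  TopCat.ofHom ⟨Set.inclusion h, continuous_inclusion h⟩

instance {X : TopCat.{w}} {A B : Set X} (h : A ⊆ B) : Mono (inclusion h) :=
  (TopCat.mono_iff_injective _).2 (Set.inclusion_injective h)

section Homology

variable (k : Type u) [Field k]

/-- The singular chain complex `C(X; k)`. -/
abbrev chains : TopCat.{w} ⥤ ChainComplex (ModuleCat.{max u w} k) ℕ :=
  (AlgebraicTopology.singularChainComplexFunctor.{w} (ModuleCat.{max u w} k)).obj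
    (ModuleCat.of k (ULift.{w} k))

/-- Singular homology `H_i(X; k)` for `i : ℤ`; it is zero in negative degrees. -/
def singularH : ℤ → TopCat.{w} ⥤ ModuleCat.{max u w} k
  | Int.ofNat n =>
      (AlgebraicTopology.singularHomologyFunctor.{w} (ModuleCat.{max u w} k) n).obj
        (ModuleCat.of k (ULift.{w} k))
  | Int.negSucc _ => (Functor.const _).obj (ModuleCat.of k PUnit)

variable {X : TopCat.{w}} {A U V W : Set X} (hA : A = U ∩ V) (hW : W = U ∪ V)

/-- The morphism of complexes `C(U ∩ V) ⟶ C(U) ⊕ C(V)`, `c ↦ (c, -c)`. -/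
def interToSum : (chains k).obj (TopCat.of A) ⟶
    (chains k).obj (TopCat.of U) ⊞ (chains k).obj (TopCat.of V) :=
  biprod.lift ((chains k).map (inclusion (hA.le.trans Set.inter_subset_left)))
    (-(chains k).map (inclusion (hA.le.trans Set.inter_subset_right)))

/-- The morphism of complexes `C(U) ⊕ C(V) ⟶ C(U ∪ V)`, `(a, b) ↦ a + b`. -/
def sumToUnion : (chains k).obj (TopCat.of U) ⊞ (chains k).obj (TopCat.of V) ⟶
    (chains k).obj (TopCat.of W) :=
  biprod.desc ((chains k).map (inclusion (Set.subset_union_left.trans hW.ge)))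
    ((chains k).map (inclusion (Set.subset_union_right.trans hW.ge)))

lemma interToSum_sumToUnion : interToSum k hA ≫ sumToUnion k hW = 0 := by
  have h : inclusion (hA.le.trans Set.inter_subset_left) ≫
        inclusion (Set.subset_union_left.trans hW.ge) =
      inclusion (hA.le.trans Set.inter_subset_right) ≫
        inclusion (Set.subset_union_right.trans hW.ge) := rfl
  rw [interToSum, sumToUnion, biprod.lift_desc, Preadditive.neg_comp, ← Functor.map_comp,
    ← Functor.map_comp, h, add_neg_cancel]

instance : Mono (interToSum k hA) := by
  have : Mono (interToSum k hA ≫ biprod.fst) := by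
    rw [interToSum, biprod.lift_fst]
    infer_instance
  exact mono_of_mono _ biprod.fst

/-- The short exact sequence `0 ⟶ C(U ∩ V) ⟶ C(U) ⊕ C(V) ⟶ C(U) + C(V) ⟶ 0`. The third term is
taken to be the cokernel of the first map: since `C(U)` and `C(V)` are subcomplexes of `C(U ∪ V)`
with intersection `C(U ∩ V)`, this is the subcomplex `C(U) + C(V)` of `C(U ∪ V)`, embedded by
`smallChainsMap`. -/
def mvShortComplex : ShortComplex (ChainComplex (ModuleCat.{max u w} k) ℕ) :=
  ShortComplex.mk (interToSum k hA) (cokernel.π (interToSum k hA)) (cokernel.condition _)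

lemma mvShortComplex_shortExact : (mvShortComplex k hA).ShortExact where
  exact := ShortComplex.exact_cokernel _
  mono_f := inferInstanceAs (Mono (interToSum k hA))
  epi_g := inferInstanceAs (Epi (cokernel.π (interToSum k hA)))

/-- The canonical morphism `C(U) + C(V) ⟶ C(U ∪ V)`. -/
def smallChainsMap : (mvShortComplex k hA).X₃ ⟶ (chains k).obj (TopCat.of W) :=
  cokernel.desc _ (sumToUnion k hW) (interToSum_sumToUnion k hA hW)

open scoped Classical in
/-- The connecting homomorphism `H_{n+1}(U ∪ V) ⟶ H_n(U ∩ V)` of the Mayer-Vietoris sequence: the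
inverse of the isomorphism `H_{n+1}(C(U) + C(V)) ≅ H_{n+1}(U ∪ V)` followed by the connecting
homomorphism of the long exact homology sequence of the short exact sequence of complexes above.
If the former map is not an isomorphism (which does not happen if `U` and `V` are open), the value
is `0`. -/
def mvConnectingNat (n : ℕ) :
    ((chains k).obj (TopCat.of W)).homology (n + 1) ⟶
      ((chains k).obj (TopCat.of A)).homology n :=
  if h : IsIso (HomologicalComplex.homologyMap (smallChainsMap k hA hW) (n + 1)) then
    @inv _ _ _ _ _ h ≫ (mvShortComplex_shortExact k hA).δ (n + 1) n rfl
  else 0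

/-- The Mayer-Vietoris connecting homomorphism `H_{i+1}(U ∪ V) ⟶ H_i(U ∩ V)`, for `i : ℤ`. -/
def mvConnecting : ∀ i : ℤ,
    (singularH.{u, w} k (i + 1)).obj (TopCat.of W) ⟶ (singularH.{u, w} k i).obj (TopCat.of A)
  | Int.ofNat n => mvConnectingNat k hA hW n
  | Int.negSucc _ => 0

end Homology

/-! ### The persistence modules of level sets -/

section LevelSets

/-- The set `f⁻¹(]-x₁, x₂[)`. -/
def levelSet (f : TopOverReal.{w}) (x : DeltaPlus) : Set f.X :=
  f.fn ⁻¹' Set.Ioo (-x.1.1) x.1.2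

lemma levelSet_mono (f : TopOverReal.{w}) {x y : DeltaPlus} (h : x ≤ y) :
    levelSet f x ⊆ levelSet f y :=
  Set.preimage_mono (Set.Ioo_subset_Ioo (neg_le_neg h.1) h.2)

lemma levelSet_eq_inter (f : TopOverReal.{w}) (x : DeltaPlus) (s : PosVec) :
    levelSet f x = levelSet f (x.add s.sx) ∩ levelSet f (x.add s.sy) := by
  refine Set.Subset.antisymm (Set.subset_inter (levelSet_mono f (x.le_add _))
    (levelSet_mono f (x.le_add _))) ?_
  rintro p ⟨⟨_, h2⟩, ⟨h3, _⟩⟩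
  simp only [DeltaPlus.add, PosVec.sx, PosVec.sy, NNReal.coe_zero, add_zero] at h2 h3
  exact ⟨h3, h2⟩

lemma levelSet_eq_union (f : TopOverReal.{w}) (x : DeltaPlus) (s : PosVec) :
    levelSet f (x.add s.1) = levelSet f (x.add s.sx) ∪ levelSet f (x.add s.sy) := by
  refine Set.Subset.antisymm ?_ (Set.union_subset
    (levelSet_mono f (DeltaPlus.add_mono le_rfl s.sx_le))
    (levelSet_mono f (DeltaPlus.add_mono le_rfl s.sy_le)))
  rintro p ⟨h1, h2⟩
  have hx := x.2
  rcases lt_or_ge (f.fn p) x.1.2 with h | h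
  · left
    refine ⟨h1, ?_⟩
    simpa [DeltaPlus.add, PosVec.sx] using h
  · right
    refine ⟨?_, h2⟩
    simp only [DeltaPlus.add, PosVec.sy, NNReal.coe_zero, add_zero]
    linarith

/-- The functor `x ↦ f⁻¹(]-x₁, x₂[)` from `Δ⁺` to topological spaces. -/
def levelSpace (f : TopOverReal.{w}) : DeltaPlus ⥤ TopCat.{w} where
  obj x := TopCat.of (levelSet f x)
  map h := inclusion (levelSet_mono f (leOfHom h))

/-- The restrictions `f⁻¹(]-x₁, x₂[) ⟶ g⁻¹(]-x₁, x₂[)` of a morphism `φ` from `f` to `g`. -/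
def levelSpaceMap {f g : TopOverReal.{w}} (φ : f ⟶ g) : levelSpace f ⟶ levelSpace g where
  app x := TopCat.ofHom
    { toFun := fun p => ⟨φ.map p.1, by
        have h := p.2
        simp only [levelSet, Set.mem_preimage] at h ⊢
        rwa [φ.comm p.1]⟩
      continuous_toFun := by fun_prop }

variable (k : Type u) [Field k]

/-- The level set persistence module `M_i^f`, `x ↦ H_i(f⁻¹(]-x₁, x₂[); k)`. -/
abbrev levelSetModule (f : TopOverReal.{w}) (i : ℤ) : Pers.{u, max u w} k :=
  levelSpace f ⋙ singularH.{u, w} k i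

/-- The morphism `φ_* : M_i^f ⟶ M_i^g` induced by a morphism `φ` from `f` to `g`. -/
abbrev levelSetModuleMap {f g : TopOverReal.{w}} (φ : f ⟶ g) (i : ℤ) :
    levelSetModule k f i ⟶ levelSetModule k g i :=
  Functor.whiskerRight (levelSpaceMap φ) (singularH.{u, w} k i)

/-- The morphism `C(U) + C(V) ⟶ C(f⁻¹(]-x₁-s₁, x₂+s₂[))` for `U = f⁻¹(]-x₁-s₁, x₂[)` and
`V = f⁻¹(]-x₁, x₂+s₂[)`. -/
abbrev levelSetSmallChainsMap (f : TopOverReal.{w}) (s : PosVec) (x : DeltaPlus) :=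
  smallChainsMap.{u, w} k (levelSet_eq_inter f x s) (levelSet_eq_union f x s)

/-- The Mayer-Vietoris connecting homomorphism
`H_{i+1}(f⁻¹(]-x₁-s₁, x₂+s₂[)) ⟶ H_i(f⁻¹(]-x₁, x₂[))` for the open cover of
`f⁻¹(]-x₁-s₁, x₂+s₂[)` by `f⁻¹(]-x₁-s₁, x₂[)` and `f⁻¹(]-x₁, x₂+s₂[)`. -/
def levelSetConnecting (f : TopOverReal.{w}) (i : ℤ) (s : PosVec) (x : DeltaPlus) :
    (shift s.1 (levelSetModule.{u, w} k f (i + 1))).obj x ⟶ (levelSetModule.{u, w} k f i).obj x :=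
  mvConnecting k (levelSet_eq_inter f x s) (levelSet_eq_union f x s) i

end LevelSets

end

end MayerVietoris

/-!
The only topological input is the small chains theorem for a cover of a space by open sets: the
inclusion of the chains that are small with respect to the cover into all singular chains is a
quasi-isomorphism (`quasiIso_smallChainsMap`). Given this, the Mayer-Vietoris sequence of a cover is
the long exact homology sequence of `0 ⟶ C(U ∩ V) ⟶ C(U) ⊕ C(V) ⟶ C(U) + C(V) ⟶ 0`, and all the
compatibilities (with the structural maps, with a change of `s`, and with maps over `ℝ`) are
instances of its naturality with respect to maps of covers (`mvConnecting_naturality`). In degree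
zero exactness on the right means that `H_0(U) ⊕ H_0(V) ⟶ H_0(U ∪ V)` is surjective.

The small chains theorem is proved by barycentric subdivision. The combinatorics takes place in the
augmented complex of ordered chains on a set `E` of vertices, where adding a vertex `b` in front of
a tuple is a contraction `K_b`. If `E` has barycenters, define a chain homotopy `T` recursively by
`T v = K_{bar v} (v - T ∂v)`; then the operator `S = 1 - ∂T - T∂` satisfies
`S v = K_{bar v} (S ∂v)`, so it is barycentric subdivision. When `E` is a standard simplex, `S`
contracts the diameters of simplices of dimension at most `q` by `q / (q + 1)` (`subdiv_diam`).
Pushing the subdivided standard simplex forward along singular simplices gives natural operators on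
singular chains, again with `S = 1 - ∂T - T∂`. By naturality `T` and `S` preserve small chains, and
by Lebesgue's lemma a power of `S` makes any given chain small. Hence a chain with small boundary is
small up to a boundary (`exists_sub_d_mem_smallChains`), that is, the quotient of all chains by the
small ones is acyclic.
-/

namespace MayerVietoris

noncomputable section

/-! ### Ordered chains and their barycentric subdivision -/

section OrderedChains

variable (k : Type u) [Field k] {E : Type*} {E' : Type*}

/-- Ordered chains on the set `E`: formal combinations of `n`-tuples of vertices. The index `n` is
the number of vertices, so the degree is `n - 1`, and `n = 0` is the augmentation term. -/
abbrev OrdChain (E : Type*) (n : ℕ) : Type _ := (Fin n → E) →₀ k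

variable {k}

namespace OrdChain

/-- The boundary, `v ↦ ∑ (-1)ⁱ (v with the i-th vertex removed)`. -/
def bd (n : ℕ) : OrdChain k E (n + 1) →ₗ[k] OrdChain k E n :=
  Finsupp.linearCombination k fun v : Fin (n + 1) → E =>
    ∑ i : Fin (n + 1), (-1 : k) ^ (i : ℕ) • Finsupp.single (v ∘ i.succAbove) (1 : k)

/-- The cone with apex `b`: the vertex `b` is put in front of each tuple. -/
def cone (b : E) (n : ℕ) : OrdChain k E n →ₗ[k] OrdChain k E (n + 1) :=
  Finsupp.lmapDomain k k fun v => (Fin.cons b v : Fin (n + 1) → E)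

/-- The map of ordered chains induced by a map of vertices. -/
def map (f : E → E') (n : ℕ) : OrdChain k E n →ₗ[k] OrdChain k E' n :=
  Finsupp.lmapDomain k k fun v => f ∘ v

lemma bd_single (n : ℕ) (v : Fin (n + 1) → E) :
    bd n (Finsupp.single v (1 : k)) =
      ∑ i : Fin (n + 1), (-1 : k) ^ (i : ℕ) • Finsupp.single (v ∘ i.succAbove) (1 : k) := by
  simp [bd]

lemma cone_single (b : E) (n : ℕ) (v : Fin n → E) :
    cone b n (Finsupp.single v (1 : k)) = Finsupp.single (Fin.cons b v : Fin (n + 1) → E) 1 := by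
  simp [cone]

lemma map_single (f : E → E') (n : ℕ) (v : Fin n → E) :
    map f n (Finsupp.single v (1 : k)) = Finsupp.single (f ∘ v) 1 := by
  simp [map]

lemma hom_ext {n : ℕ} {M : Type*} [AddCommGroup M] [Module k M] {f g : OrdChain k E n →ₗ[k] M}
    (h : ∀ v, f (Finsupp.single v 1) = g (Finsupp.single v 1)) : f = g := by
  refine Finsupp.lhom_ext' fun v => LinearMap.ext_ring ?_
  simpa using h v

lemma map_bd (f : E → E') (n : ℕ) (x : OrdChain k E (n + 1)) :
    map f n (bd n x) = bd n (map f (n + 1) x) := by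
  refine LinearMap.congr_fun (f := (map f n) ∘ₗ bd n) (g := bd n ∘ₗ map f (n + 1))
    (hom_ext fun v => ?_) x
  simp only [LinearMap.comp_apply, bd_single, map_single, map_sum, map_smul, Function.comp_assoc]

lemma map_cone (f : E → E') (b : E) (n : ℕ) (x : OrdChain k E n) :
    map f (n + 1) (cone b n x) = cone (f b) n (map f n x) := by
  refine LinearMap.congr_fun (f := (map f (n + 1)) ∘ₗ cone b n) (g := cone (f b) n ∘ₗ map f n)
    (hom_ext fun v => ?_) x
  simp only [LinearMap.comp_apply, cone_single, map_single]
  rw [Fin.comp_cons]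

lemma bd_cone_zero (b : E) (x : OrdChain k E 0) : bd 0 (cone b 0 x) = x := by
  refine LinearMap.congr_fun (f := bd 0 ∘ₗ cone b 0) (g := LinearMap.id)
    (hom_ext fun v => ?_) x
  simp only [LinearMap.comp_apply, cone_single, bd_single]
  simp [Subsingleton.elim _ v]

/-- The cone is a contracting homotopy of the augmented complex of ordered chains. -/
lemma bd_cone (b : E) (n : ℕ) (x : OrdChain k E (n + 1)) :
    bd (n + 1) (cone b (n + 1) x) = x - cone b n (bd n x) := by
  refine LinearMap.congr_fun (f := bd (n + 1) ∘ₗ cone b (n + 1))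
    (g := LinearMap.id - cone b n ∘ₗ bd n) (hom_ext fun v => ?_) x
  simp only [LinearMap.comp_apply, LinearMap.sub_apply, LinearMap.id_apply, cone_single, bd_single,
    map_sum, map_smul]
  rw [Fin.sum_univ_succ, sub_eq_add_neg, ← Finset.sum_neg_distrib]
  congr 1
  · simp only [Fin.val_zero, pow_zero, one_smul, Fin.succAbove_zero]
    rfl
  · refine Finset.sum_congr rfl fun i _ => ?_
    have : (Fin.cons b v : Fin (n + 2) → E) ∘ i.succ.succAbove = Fin.cons b (v ∘ i.succAbove) := by
      funext j
      refine Fin.cases ?_ (fun j => ?_) j <;> simp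
    rw [this, Fin.val_succ, pow_succ, mul_neg_one, neg_smul]

lemma bd_bd (n : ℕ) (x : OrdChain k E (n + 2)) : bd n (bd (n + 1) x) = 0 := by
  -- Every tuple is a cone, and the cone operator is a contraction.
  induction n with
  | zero =>
    refine LinearMap.congr_fun (f := bd 0 ∘ₗ bd 1) (g := 0) (hom_ext fun v => ?_) x
    rw [← Fin.cons_self_tail v, ← cone_single, LinearMap.comp_apply, bd_cone, map_sub,
      bd_cone_zero, sub_self, LinearMap.zero_apply]
  | succ n ih =>
    refine LinearMap.congr_fun (f := bd (n + 1) ∘ₗ bd (n + 2)) (g := 0) (hom_ext fun v => ?_) x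
    rw [← Fin.cons_self_tail v, ← cone_single, LinearMap.comp_apply, bd_cone, map_sub,
      bd_cone, ih, map_zero, sub_zero, sub_self, LinearMap.zero_apply]

/-- The chain homotopy `T` between the identity and barycentric subdivision, where `bar v` is the
barycenter of the tuple `v`: it is zero on the augmentation term, and `T v` is the cone over
`v - T ∂v` from the barycenter of `v`. -/
def homotopy (bar : ∀ n, (Fin (n + 1) → E) → E) :
    ∀ n, OrdChain k E n →ₗ[k] OrdChain k E (n + 1)
  | 0 => 0
  | n + 1 => Finsupp.linearCombination k fun v : Fin (n + 1) → E =>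
      cone (bar n v) (n + 1)
        (Finsupp.single v 1 - homotopy bar n (bd n (Finsupp.single v 1)))

/-- Barycentric subdivision `1 - ∂T - T∂`, where `T` is the homotopy above. -/
def subdiv (bar : ∀ n, (Fin (n + 1) → E) → E) : ∀ n, OrdChain k E n →ₗ[k] OrdChain k E n
  | 0 => LinearMap.id
  | n + 1 => LinearMap.id - bd (n + 1) ∘ₗ homotopy bar (n + 1) - homotopy bar n ∘ₗ bd n

variable (bar : ∀ n, (Fin (n + 1) → E) → E)

lemma homotopy_single (n : ℕ) (v : Fin (n + 1) → E) :
    homotopy bar (n + 1) (Finsupp.single v (1 : k)) = cone (bar n v) (n + 1)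
      (Finsupp.single v 1 - homotopy bar n (bd n (Finsupp.single v 1))) := by
  simp [homotopy]

lemma subdiv_succ (n : ℕ) (x : OrdChain k E (n + 1)) :
    subdiv bar (n + 1) x = x - bd (n + 1) (homotopy bar (n + 1) x) - homotopy bar n (bd n x) :=
  rfl

/-- The subdivision of a simplex is the cone, from its barycenter, over the subdivision of its
boundary. -/
lemma subdiv_single (n : ℕ) (v : Fin (n + 1) → E) :
    subdiv bar (n + 1) (Finsupp.single v (1 : k)) =
      cone (bar n v) n (subdiv bar n (bd n (Finsupp.single v 1))) := by
  rw [subdiv_succ, homotopy_single, bd_cone, map_sub]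
  rcases n with _ | n
  · simp [homotopy, subdiv]
  · rw [subdiv_succ, bd_bd, map_zero, sub_zero]
    abel

/-- Naturality of the homotopy with respect to maps that preserve barycenters. -/
lemma map_homotopy (bar' : ∀ n, (Fin (n + 1) → E') → E') (f : E → E')
    (hf : ∀ n v, f (bar n v) = bar' n (f ∘ v)) (n : ℕ) (x : OrdChain k E n) :
    map f (n + 1) (homotopy bar n x) = homotopy bar' n (map f n x) := by
  induction n with
  | zero => simp [homotopy]
  | succ n ih =>
    refine LinearMap.congr_fun (f := map f (n + 2) ∘ₗ homotopy bar (n + 1))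
      (g := homotopy bar' (n + 1) ∘ₗ map f (n + 1)) (hom_ext fun v => ?_) x
    rw [LinearMap.comp_apply, LinearMap.comp_apply, homotopy_single, map_cone, map_sub, ih,
      map_bd, map_single, homotopy_single, hf]

/-- A linear map sends the chains of tuples from `B` into a submodule `N` as soon as it does so for
single tuples. -/
lemma map_mem_of_supported {n : ℕ} {M : Type*} [AddCommGroup M] [Module k M]
    (f : OrdChain k E n →ₗ[k] M) (B : Set (Fin n → E)) (N : Submodule k M)
    (h : ∀ v ∈ B, f (Finsupp.single v 1) ∈ N) {x : OrdChain k E n}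
    (hx : x ∈ Finsupp.supported k k B) : f x ∈ N := by
  rw [Finsupp.supported_eq_span_single] at hx
  have : Submodule.span k ((fun i => Finsupp.single i (1 : k)) '' B) ≤ N.comap f := by
    rw [Submodule.span_le]
    rintro _ ⟨v, hv, rfl⟩
    exact h v hv
  exact this hx

end OrdChain

end OrderedChains

/-! ### Affine simplices and the diameter estimate -/

section AffineSimplices

variable {ι κ μ : Type*} [Fintype ι] [Fintype κ] [Fintype μ]

/-- The convex combination with weights `t` of a family of points of a standard simplex. -/
def convexComb (v : ι → stdSimplex ℝ κ) (t : stdSimplex ℝ ι) : stdSimplex ℝ κ :=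
  ⟨∑ i, t i • (v i).1, (convex_stdSimplex ℝ κ).sum_mem (fun i _ => t.2.1 i) t.2.2
    fun i _ => (v i).2⟩

lemma convexComb_apply (v : ι → stdSimplex ℝ κ) (t : stdSimplex ℝ ι) (j : κ) :
    convexComb v t j = ∑ i, t i * v i j := by
  change (∑ i, t i • (v i).1) j = _
  rw [Finset.sum_apply]
  rfl

lemma continuous_convexComb (v : ι → stdSimplex ℝ κ) : Continuous (convexComb v) := by
  refine Continuous.subtype_mk ?_ _
  refine continuous_finsetSum _ fun i _ => Continuous.smul
    (f := fun t : stdSimplex ℝ ι => t i) (g := fun _ => (v i).1) ?_ continuous_const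
  exact (continuous_apply i).comp continuous_subtype_val

lemma convexComb_convexComb (w : κ → stdSimplex ℝ μ) (v : ι → stdSimplex ℝ κ)
    (t : stdSimplex ℝ ι) :
    convexComb w (convexComb v t) = convexComb (fun i => convexComb w (v i)) t := by
  ext j
  simp only [convexComb_apply, Finset.mul_sum, Finset.sum_mul]
  rw [Finset.sum_comm]
  simp only [mul_assoc]

lemma convexComb_vertex [DecidableEq ι] (v : ι → stdSimplex ℝ κ) (i : ι) :
    convexComb v (stdSimplex.vertex i) = v i := by
  ext j
  rw [convexComb_apply]
  simp [Pi.single_apply]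

lemma vertex_convexComb [DecidableEq ι] (t : stdSimplex ℝ ι) :
    convexComb stdSimplex.vertex t = t := by
  ext j
  rw [convexComb_apply]
  simp [Pi.single_apply]

lemma convexComb_map (v : κ → stdSimplex ℝ μ) (f : ι → κ) (t : stdSimplex ℝ ι) :
    convexComb v (stdSimplex.map f t) = convexComb (v ∘ f) t := by
  classical
  ext j
  simp only [convexComb_apply, stdSimplex.map_coe, FunOnFinite.linearMap_apply_apply,
    Finset.sum_mul, Function.comp_apply]
  rw [← Finset.sum_fiberwise Finset.univ f]
  refine Finset.sum_congr rfl fun b _ => Finset.sum_congr rfl fun a ha => ?_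
  rw [(Finset.mem_filter.1 ha).2]

lemma dist_convexComb_le (v : ι → stdSimplex ℝ κ) (t : stdSimplex ℝ ι) (x : stdSimplex ℝ κ)
    {R : ℝ} (h : ∀ i, dist (v i) x ≤ R) : dist (convexComb v t) x ≤ R :=
  (convex_closedBall x.1 R).sum_mem (fun i _ => t.2.1 i) t.2.2 fun i _ => h i

/-- The barycenter of a tuple of points of a standard simplex. -/
def bary (n : ℕ) (v : Fin (n + 1) → stdSimplex ℝ κ) : stdSimplex ℝ κ :=
  convexComb v stdSimplex.barycenter

lemma convexComb_bary (w : κ → stdSimplex ℝ μ) (n : ℕ) (v : Fin (n + 1) → stdSimplex ℝ κ) :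
    convexComb w (bary n v) = bary n (convexComb w ∘ v) :=
  convexComb_convexComb _ _ _

lemma dist_bary_le (n : ℕ) (v : Fin (n + 1) → stdSimplex ℝ κ) {D : ℝ}
    (h : ∀ i j, dist (v i) (v j) ≤ D) (i : Fin (n + 1)) :
    dist (v i) (bary n v) ≤ n / (n + 1) * D := by
  have hn : (0 : ℝ) < n + 1 := by positivity
  have hD : 0 ≤ D := dist_nonneg.trans (h i i)
  refine (dist_pi_le_iff (by positivity)).2 fun j => ?_
  have hb : (bary n v).1 j = ∑ l, (n + 1 : ℝ)⁻¹ * v l j := by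
    refine (convexComb_apply _ _ _).trans (Finset.sum_congr rfl fun l _ => ?_)
    congr 1
    refine (stdSimplex.barycenter_apply l).trans ?_
    simp
  have hv : (v i).1 j = ∑ _l : Fin (n + 1), (n + 1 : ℝ)⁻¹ * v i j := by
    rw [Finset.sum_const, Finset.card_univ, Fintype.card_fin, nsmul_eq_mul]
    push_cast
    rw [mul_inv_cancel_left₀ hn.ne']
    rfl
  -- The summand of index `i` vanishes, which leaves `n` terms of size at most `D / (n + 1)`.
  rw [Real.dist_eq, hb, hv, ← Finset.sum_sub_distrib,
    ← Finset.add_sum_erase _ _ (Finset.mem_univ i), sub_self, zero_add]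
  refine (Finset.abs_sum_le_sum_abs _ _).trans ?_
  refine (Finset.sum_le_card_nsmul _ _ ((n + 1 : ℝ)⁻¹ * D) fun l _ => ?_).trans ?_
  · rw [← mul_sub, abs_mul, abs_of_pos (inv_pos.2 hn)]
    refine mul_le_mul_of_nonneg_left ?_ (inv_pos.2 hn).le
    exact (dist_le_pi_dist (v i).1 (v l).1 j).trans (h i l)
  · rw [Finset.card_erase_of_mem (Finset.mem_univ i), Finset.card_univ, Fintype.card_fin,
      nsmul_eq_mul, Nat.add_sub_cancel]
    apply le_of_eq
    field_simp

variable {k : Type u} [Field k]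

/-- Barycentric subdivision does not leave a closed ball. -/
lemma subdiv_mem_ball (n : ℕ) (x : stdSimplex ℝ κ) (R : ℝ) {c : OrdChain k (stdSimplex ℝ κ) n}
    (hc : c ∈ Finsupp.supported k k {v | ∀ i, dist (v i) x ≤ R}) :
    OrdChain.subdiv bary n c ∈ Finsupp.supported k k {v | ∀ i, dist (v i) x ≤ R} := by
  induction n with
  | zero => exact hc
  | succ n ih =>
    refine OrdChain.map_mem_of_supported _ _ _ (fun v hv => ?_) hc
    rw [OrdChain.subdiv_single]
    refine OrdChain.map_mem_of_supported _ _ _ (fun w hw => ?_) (ih (c := OrdChain.bd n _) ?_)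
    · rw [OrdChain.cone_single]
      refine Finsupp.single_mem_supported k _ fun i => ?_
      refine Fin.cases ?_ (fun i => ?_) i
      · simpa [bary] using dist_convexComb_le v _ x hv
      · simpa using hw i
    · rw [OrdChain.bd_single]
      exact Submodule.sum_mem _ fun i _ => Submodule.smul_mem _ _
        (Finsupp.single_mem_supported k _ fun j => hv _)

/-- Barycentric subdivision contracts the diameters of simplices of dimension at most `q` by the
factor `q / (q + 1)`. Here `n` is the number of vertices, one more than the dimension. -/
lemma subdiv_diam (q n : ℕ) (hn : n ≤ q + 1) {D : ℝ} {c : OrdChain k (stdSimplex ℝ κ) n}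
    (hc : c ∈ Finsupp.supported k k {v | ∀ i j, dist (v i) (v j) ≤ D}) :
    OrdChain.subdiv bary n c ∈
      Finsupp.supported k k {v | ∀ i j, dist (v i) (v j) ≤ q / (q + 1) * D} := by
  induction n with
  | zero => exact (Finsupp.mem_supported k _).2 fun v _ i => i.elim0
  | succ n ih =>
    refine OrdChain.map_mem_of_supported _ _ _ (fun v hv => ?_) hc
    have hD : 0 ≤ D := dist_nonneg.trans (hv 0 0)
    have hr : (n : ℝ) / (n + 1) ≤ q / (q + 1) := by
      have : (n : ℝ) ≤ q := by exact_mod_cast Nat.le_of_succ_le_succ hn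
      rw [div_le_div_iff₀ (by positivity) (by positivity)]
      nlinarith
    have hb : ∀ i, dist (v i) (bary n v) ≤ q / (q + 1) * D := fun i =>
      (dist_bary_le n v hv i).trans (mul_le_mul_of_nonneg_right hr hD)
    rw [OrdChain.subdiv_single]
    have h1 : OrdChain.subdiv bary n (OrdChain.bd n (Finsupp.single v (1 : k))) ∈
        Finsupp.supported k k {v | ∀ i j, dist (v i) (v j) ≤ q / (q + 1) * D} := by
      refine ih (by lia) ?_
      rw [OrdChain.bd_single]
      exact Submodule.sum_mem _ fun i _ => Submodule.smul_mem _ _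
        (Finsupp.single_mem_supported k _ fun j l => hv _ _)
    have h2 : OrdChain.subdiv bary n (OrdChain.bd n (Finsupp.single v (1 : k))) ∈
        Finsupp.supported k k {w | ∀ i, dist (w i) (bary n v) ≤ q / (q + 1) * D} := by
      refine subdiv_mem_ball n _ _ ?_
      rw [OrdChain.bd_single]
      exact Submodule.sum_mem _ fun i _ => Submodule.smul_mem _ _
        (Finsupp.single_mem_supported k _ fun j => hb _)
    have h3 := Submodule.mem_inf.2 ⟨h1, h2⟩
    rw [← Finsupp.supported_inter] at h3
    refine OrdChain.map_mem_of_supported _ _ _ (fun w hw => ?_) h3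
    rw [OrdChain.cone_single]
    refine Finsupp.single_mem_supported k _ fun i j => ?_
    refine Fin.cases ?_ (fun i => ?_) i <;> refine Fin.cases ?_ (fun j => ?_) j
    · simp only [Fin.cons_zero, dist_self]
      positivity
    · simpa [dist_comm] using hw.2 j
    · simpa using hw.2 i
    · simpa using hw.1 i j

/-- Iterated barycentric subdivision makes all simplices arbitrarily small. -/
lemma exists_subdiv_iterate_diam (n : ℕ) {ε : ℝ} (hε : 0 < ε)
    (v : Fin (n + 1) → stdSimplex ℝ κ) :
    ∃ N : ℕ, (OrdChain.subdiv bary (n + 1))^[N] (Finsupp.single v (1 : k)) ∈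
      Finsupp.supported k k {v | ∀ i j, dist (v i) (v j) < ε} := by
  obtain ⟨D, hD⟩ : ∃ D, ∀ i j, dist (v i) (v j) ≤ D := by
    obtain ⟨D, hD⟩ := (Set.finite_range fun p : Fin (n + 1) × Fin (n + 1) =>
      dist (v p.1) (v p.2)).bddAbove
    exact ⟨D, fun i j => hD ⟨(i, j), rfl⟩⟩
  have hN : ∀ N : ℕ, (OrdChain.subdiv bary (n + 1))^[N] (Finsupp.single v (1 : k)) ∈
      Finsupp.supported k k {v | ∀ i j, dist (v i) (v j) ≤ ((n : ℝ) / (n + 1)) ^ N * D} := by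
    intro N
    induction N with
    | zero => exact Finsupp.single_mem_supported k _ (by simpa using hD)
    | succ N ih =>
      rw [Function.iterate_succ_apply', pow_succ', mul_assoc]
      exact subdiv_diam n (n + 1) le_rfl ih
  have hlim : Filter.Tendsto (fun N : ℕ => ((n : ℝ) / (n + 1)) ^ N * D) Filter.atTop (nhds 0) := by
    rw [← zero_mul D]
    refine (tendsto_pow_atTop_nhds_zero_of_lt_one (by positivity) ?_).mul_const D
    rw [div_lt_one (by positivity)]
    linarith
  obtain ⟨N, hlt⟩ := (hlim.eventually_lt_const hε).exists
  exact ⟨N, Finsupp.supported_mono (fun w hw i j => (hw i j).trans_lt hlt) (hN N)⟩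

end AffineSimplices

/-! ### Singular chains -/

section SingularChains

variable (k : Type u) [Field k]

/-- The singular simplex `σ`, as a singular chain. -/
def singChain {X : TopCat.{w}} {n : ℕ} (σ : C(stdSimplex ℝ (Fin (n + 1)), X)) :
    ((chains k).obj X).X n :=
  ((TopCat.toSSet.obj X).ιChainComplex (R := ModuleCat.of k (ULift.{w} k)) (n := n)
    ((X.toSSetObjEquiv (.op (.mk n))).symm σ)).hom (ULift.up 1)

/-- The `i`-th face inclusion between standard simplices. -/
def faceMap {n : ℕ} (i : Fin (n + 2)) :
    C(stdSimplex ℝ (Fin (n + 1)), stdSimplex ℝ (Fin (n + 2))) :=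
  ⟨stdSimplex.map i.succAbove, stdSimplex.continuous_map _⟩

variable {k} {X Y : TopCat.{w}} {n : ℕ}

lemma chains_hom_ext {M : ModuleCat.{max u w} k} {f g : ((chains k).obj X).X n ⟶ M}
    (h : ∀ σ : C(stdSimplex ℝ (Fin (n + 1)), X), f (singChain k σ) = g (singChain k σ)) :
    f = g := by
  refine SSet.chainComplex_hom_ext (X := TopCat.toSSet.obj X)
    (R := ModuleCat.of k (ULift.{w} k)) fun x => ?_
  refine ModuleCat.hom_ext (LinearMap.ext fun c => ?_)
  have hc : c = c.down • (ULift.up 1 : ULift.{w} k) := by ext; simp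
  have := h (X.toSSetObjEquiv (.op (.mk n)) x)
  rw [singChain, Equiv.symm_apply_apply] at this
  rw [hc, map_smul, map_smul]
  exact congrArg (c.down • ·) this

/-- The linear map on singular chains with prescribed values on singular simplices. -/
def chainsLift {M : ModuleCat.{max u w} k} (g : C(stdSimplex ℝ (Fin (n + 1)), X) → M) :
    ((chains k).obj X).X n ⟶ M :=
  Cofan.IsColimit.desc (SSet.isColimitChainComplexXCofan (TopCat.toSSet.obj X)
    (ModuleCat.of k (ULift.{w} k)) n) fun x =>
      ModuleCat.ofHom ((LinearMap.toSpanSingleton k M (g (X.toSSetObjEquiv (.op (.mk n)) x))) ∘ₗ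
        ULift.moduleEquiv.toLinearMap)

lemma chainsLift_singChain {M : ModuleCat.{max u w} k} (g : C(stdSimplex ℝ (Fin (n + 1)), X) → M)
    (σ : C(stdSimplex ℝ (Fin (n + 1)), X)) : chainsLift g (singChain k σ) = g σ := by
  have := Cofan.IsColimit.fac (SSet.isColimitChainComplexXCofan (TopCat.toSSet.obj X)
    (ModuleCat.of k (ULift.{w} k)) n) (fun x =>
      ModuleCat.ofHom ((LinearMap.toSpanSingleton k M (g (X.toSSetObjEquiv (.op (.mk n)) x))) ∘ₗ
        ULift.moduleEquiv.toLinearMap)) ((X.toSSetObjEquiv (.op (.mk n))).symm σ)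
  have := ConcreteCategory.congr_hom this (ULift.up 1)
  refine Eq.trans this ?_
  simp

lemma d_singChain (σ : C(stdSimplex ℝ (Fin (n + 2)), X)) :
    ((chains k).obj X).d (n + 1) n (singChain k σ) =
      ∑ i : Fin (n + 2), (-1 : k) ^ (i : ℕ) • singChain k (σ.comp (faceMap i)) := by
  have := congrArg ModuleCat.Hom.hom (SSet.ιChainComplex_d (TopCat.toSSet.obj X)
    (R := ModuleCat.of k (ULift.{w} k)) ((X.toSSetObjEquiv (.op (.mk (n + 1)))).symm σ))
  rw [ModuleCat.hom_sum] at this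
  refine (LinearMap.congr_fun this (ULift.up 1)).trans ?_
  rw [LinearMap.sum_apply]
  refine (Finset.sum_congr rfl fun i _ => ?_)
  have hface : (TopCat.toSSet.obj X).δ i ((X.toSSetObjEquiv (.op (.mk (n + 1)))).symm σ) =
    (X.toSSetObjEquiv (.op (.mk n))).symm (σ.comp (faceMap i)) := rfl
  rw [hface, ModuleCat.hom_zsmul, LinearMap.smul_apply, ← Int.cast_smul_eq_zsmul k]
  push_cast
  rfl

lemma chainsMap_singChain (f : X ⟶ Y) (σ : C(stdSimplex ℝ (Fin (n + 1)), X)) :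
    ((chains k).map f).f n (singChain k σ) = singChain k (f.hom.comp σ) := by
  have := ConcreteCategory.congr_hom (SSet.ι_chainComplexMap_f _ _ (TopCat.toSSet.map f)
    (ModuleCat.of k (ULift.{w} k)) ((X.toSSetObjEquiv (.op (.mk n))).symm σ))
    (ULift.up 1)
  exact this

lemma span_singChain : Submodule.span k (Set.range (singChain k (X := X) (n := n))) = ⊤ := by
  rw [← Submodule.ker_mkQ (Submodule.span k (Set.range (singChain k (X := X) (n := n)))),
    LinearMap.ker_eq_top]
  have : ModuleCat.ofHom (Submodule.mkQ (Submodule.span k (Set.range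
      (singChain k (X := X) (n := n))))) = 0 := chains_hom_ext fun σ => by
    simpa using Submodule.subset_span (Set.mem_range_self σ)
  exact congrArg ModuleCat.Hom.hom this

end SingularChains

/-! ### Barycentric subdivision of singular chains -/

section Subdivision

/-- The affine singular simplex with given vertices in a standard simplex. -/
def affineSimplex {κ : Type*} [Fintype κ] {m : ℕ} (v : Fin (m + 1) → stdSimplex ℝ κ) :
    C(stdSimplex ℝ (Fin (m + 1)), stdSimplex ℝ κ) :=
  ⟨convexComb v, continuous_convexComb v⟩

lemma affineSimplex_comp_faceMap {κ : Type*} [Fintype κ] {m : ℕ}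
    (v : Fin (m + 2) → stdSimplex ℝ κ) (i : Fin (m + 2)) :
    (affineSimplex v).comp (faceMap i) = affineSimplex (v ∘ i.succAbove) :=
  ContinuousMap.ext fun t => convexComb_map v i.succAbove t

lemma affineSimplex_comp {κ : Type*} [Fintype κ] {m n : ℕ}
    (w : Fin (n + 1) → stdSimplex ℝ κ) (v : Fin (m + 1) → stdSimplex ℝ (Fin (n + 1))) :
    (affineSimplex w).comp (affineSimplex v) = affineSimplex (convexComb w ∘ v) :=
  ContinuousMap.ext fun t => convexComb_convexComb w v t

lemma affineSimplex_vertex (m : ℕ) :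
    affineSimplex (stdSimplex.vertex : Fin (m + 1) → stdSimplex ℝ (Fin (m + 1))) =
      ContinuousMap.id _ :=
  ContinuousMap.ext fun t => vertex_convexComb t

variable {k : Type u} [Field k] {X : TopCat.{w}}

/-- The map from ordered chains on the standard simplex to singular chains of `X` given by
composing affine simplices with a singular simplex `σ`. -/
def push {n : ℕ} (σ : C(stdSimplex ℝ (Fin (n + 1)), X)) (m : ℕ) :
    OrdChain k (stdSimplex ℝ (Fin (n + 1))) (m + 1) →ₗ[k] ((chains k).obj X).X m :=
  Finsupp.linearCombination k fun v => singChain k (σ.comp (affineSimplex v))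

lemma push_single {n : ℕ} (σ : C(stdSimplex ℝ (Fin (n + 1)), X)) (m : ℕ)
    (v : Fin (m + 1) → stdSimplex ℝ (Fin (n + 1))) :
    push σ m (Finsupp.single v (1 : k)) = singChain k (σ.comp (affineSimplex v)) := by
  simp [push]

lemma push_vertex {n : ℕ} (σ : C(stdSimplex ℝ (Fin (n + 1)), X)) :
    push σ n (Finsupp.single stdSimplex.vertex (1 : k)) = singChain k σ := by
  rw [push_single, affineSimplex_vertex, ContinuousMap.comp_id]

lemma d_push {n : ℕ} (σ : C(stdSimplex ℝ (Fin (n + 1)), X)) (m : ℕ)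
    (x : OrdChain k (stdSimplex ℝ (Fin (n + 1))) (m + 2)) :
    ((chains k).obj X).d (m + 1) m (push σ (m + 1) x) = push σ m (OrdChain.bd (m + 1) x) := by
  refine LinearMap.congr_fun (f := (((chains k).obj X).d (m + 1) m).hom ∘ₗ push σ (m + 1))
    (g := push σ m ∘ₗ OrdChain.bd (m + 1)) (OrdChain.hom_ext fun v => ?_) x
  rw [LinearMap.comp_apply, LinearMap.comp_apply, push_single, OrdChain.bd_single, map_sum]
  refine (d_singChain _).trans (Finset.sum_congr rfl fun i _ => ?_)
  rw [map_smul, push_single, ContinuousMap.comp_assoc, affineSimplex_comp_faceMap]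

lemma push_comp_affineSimplex {n p : ℕ} (σ : C(stdSimplex ℝ (Fin (n + 1)), X))
    (w : Fin (p + 1) → stdSimplex ℝ (Fin (n + 1))) (m : ℕ)
    (x : OrdChain k (stdSimplex ℝ (Fin (p + 1))) (m + 1)) :
    push (σ.comp (affineSimplex w)) m x = push σ m (OrdChain.map (convexComb w) (m + 1) x) := by
  refine LinearMap.congr_fun (f := push (σ.comp (affineSimplex w)) m)
    (g := push σ m ∘ₗ OrdChain.map (convexComb w) (m + 1)) (OrdChain.hom_ext fun v => ?_) x
  rw [LinearMap.comp_apply, push_single, OrdChain.map_single, push_single,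
    ContinuousMap.comp_assoc, affineSimplex_comp]

/-- The chain homotopy between barycentric subdivision of singular chains and the identity. -/
def singHomotopy (n : ℕ) : ((chains k).obj X).X n →ₗ[k] ((chains k).obj X).X (n + 1) :=
  (chainsLift fun σ =>
    push σ (n + 1) (OrdChain.homotopy bary (n + 1) (Finsupp.single stdSimplex.vertex 1))).hom

/-- Barycentric subdivision of singular chains, `1 - ∂T - T∂` for the homotopy `T` above. -/
def singSubdiv : ∀ n : ℕ, ((chains k).obj X).X n →ₗ[k] ((chains k).obj X).X n
  | 0 => LinearMap.id - (((chains k).obj X).d 1 0).hom ∘ₗ singHomotopy 0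
  | n + 1 => LinearMap.id - (((chains k).obj X).d (n + 2) (n + 1)).hom ∘ₗ singHomotopy (n + 1) -
      singHomotopy n ∘ₗ (((chains k).obj X).d (n + 1) n).hom

lemma singHomotopy_singChain {n : ℕ} (σ : C(stdSimplex ℝ (Fin (n + 1)), X)) :
    singHomotopy n (singChain k σ) =
      push σ (n + 1) (OrdChain.homotopy bary (n + 1) (Finsupp.single stdSimplex.vertex 1)) :=
  chainsLift_singChain _ σ

lemma singHomotopy_push {n : ℕ} (σ : C(stdSimplex ℝ (Fin (n + 1)), X)) (m : ℕ)
    (x : OrdChain k (stdSimplex ℝ (Fin (n + 1))) (m + 1)) :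
    singHomotopy m (push σ m x) = push σ (m + 1) (OrdChain.homotopy bary (m + 1) x) := by
  refine LinearMap.congr_fun (f := singHomotopy m ∘ₗ push σ m)
    (g := push σ (m + 1) ∘ₗ OrdChain.homotopy bary (m + 1)) (OrdChain.hom_ext fun v => ?_) x
  rw [LinearMap.comp_apply, LinearMap.comp_apply, push_single, singHomotopy_singChain,
    push_comp_affineSimplex, OrdChain.map_homotopy bary bary _ (convexComb_bary v),
    OrdChain.map_single]
  congr 3
  exact funext (convexComb_vertex v)

lemma singSubdiv_push {n : ℕ} (σ : C(stdSimplex ℝ (Fin (n + 1)), X)) (m : ℕ)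
    (x : OrdChain k (stdSimplex ℝ (Fin (n + 1))) (m + 1)) :
    singSubdiv m (push σ m x) = push σ m (OrdChain.subdiv bary (m + 1) x) := by
  rcases m with _ | m
  · rw [OrdChain.subdiv_succ, OrdChain.homotopy, LinearMap.zero_apply, sub_zero, map_sub,
      ← d_push, ← singHomotopy_push]
    rfl
  · rw [OrdChain.subdiv_succ, map_sub, map_sub, ← d_push, ← singHomotopy_push,
      ← singHomotopy_push, ← d_push]
    rfl

/-- The chains spanned by the singular simplices contained in some member of the family `𝒰`. -/
def smallChains (k : Type u) [Field k] (𝒰 : Set (Set X)) (n : ℕ) :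
    Submodule k (((chains k).obj X).X n) :=
  Submodule.span k (singChain k '' {σ | ∃ U ∈ 𝒰, Set.range σ ⊆ U})

variable {𝒰 : Set (Set X)}

lemma singChain_mem_smallChains {n : ℕ} {σ : C(stdSimplex ℝ (Fin (n + 1)), X)} {U : Set X}
    (hU : U ∈ 𝒰) (hσ : Set.range σ ⊆ U) : singChain k σ ∈ smallChains k 𝒰 n :=
  Submodule.subset_span ⟨σ, ⟨U, hU, hσ⟩, rfl⟩

lemma push_mem_smallChains {n : ℕ} {σ : C(stdSimplex ℝ (Fin (n + 1)), X)} {U : Set X}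
    (hU : U ∈ 𝒰) (hσ : Set.range σ ⊆ U) {m : ℕ}
    (x : OrdChain k (stdSimplex ℝ (Fin (n + 1))) (m + 1)) :
    push σ m x ∈ smallChains k 𝒰 m := by
  refine OrdChain.map_mem_of_supported _ Set.univ _ (fun v _ => ?_) (by simp)
  rw [push_single]
  exact singChain_mem_smallChains hU ((Set.range_comp_subset_range (affineSimplex v) σ).trans hσ)

lemma map_mem_smallChains {m n : ℕ}
    (f : ((chains k).obj X).X n →ₗ[k] ((chains k).obj X).X m)
    (hf : ∀ U ∈ 𝒰, ∀ σ : C(stdSimplex ℝ (Fin (n + 1)), X), Set.range σ ⊆ U →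
      f (singChain k σ) ∈ smallChains k 𝒰 m) {c : ((chains k).obj X).X n}
    (hc : c ∈ smallChains k 𝒰 n) : f c ∈ smallChains k 𝒰 m := by
  have : smallChains k 𝒰 n ≤ (smallChains k 𝒰 m).comap f := by
    refine Submodule.span_le.2 ?_
    rintro _ ⟨σ, ⟨U, hU, hσ⟩, rfl⟩
    exact hf U hU σ hσ
  exact this hc

lemma d_mem_smallChains (n m : ℕ) {c : ((chains k).obj X).X n} (hc : c ∈ smallChains k 𝒰 n) :
    ((chains k).obj X).d n m c ∈ smallChains k 𝒰 m := by
  by_cases h : m + 1 = n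
  · subst h
    refine map_mem_smallChains (((chains k).obj X).d (m + 1) m).hom (fun U hU σ hσ => ?_) hc
    rw [← push_vertex]
    refine Set.mem_of_eq_of_mem (d_push σ m _) (push_mem_smallChains hU hσ _)
  · rw [((chains k).obj X).shape n m h]
    exact Submodule.zero_mem _

lemma singHomotopy_mem_smallChains {n : ℕ} {c : ((chains k).obj X).X n}
    (hc : c ∈ smallChains k 𝒰 n) : singHomotopy n c ∈ smallChains k 𝒰 (n + 1) := by
  refine map_mem_smallChains _ (fun U hU σ hσ => ?_) hc
  rw [singHomotopy_singChain]
  exact push_mem_smallChains hU hσ _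

lemma singSubdiv_mem_smallChains {n : ℕ} {c : ((chains k).obj X).X n}
    (hc : c ∈ smallChains k 𝒰 n) : singSubdiv n c ∈ smallChains k 𝒰 n := by
  refine map_mem_smallChains _ (fun U hU σ hσ => ?_) hc
  rw [← push_vertex, singSubdiv_push]
  exact push_mem_smallChains hU hσ _

lemma iterate_singSubdiv_mem_smallChains {n : ℕ} {c : ((chains k).obj X).X n}
    (hc : c ∈ smallChains k 𝒰 n) (N : ℕ) : (singSubdiv n)^[N] c ∈ smallChains k 𝒰 n := by
  induction N with
  | zero => exact hc
  | succ N ih =>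
    rw [Function.iterate_succ_apply']
    exact singSubdiv_mem_smallChains ih

/-- By the Lebesgue number lemma, sufficiently many subdivisions make a simplex small with respect
to an open cover. -/
lemma exists_iterate_singChain_mem (hopen : ∀ U ∈ 𝒰, IsOpen U) (hcov : ⋃₀ 𝒰 = Set.univ) {n : ℕ}
    (σ : C(stdSimplex ℝ (Fin (n + 1)), X)) :
    ∃ N : ℕ, (singSubdiv n)^[N] (singChain k σ) ∈ smallChains k 𝒰 n := by
  obtain ⟨ε, hε, hball⟩ := lebesgue_number_lemma_of_metric (s := Set.univ)
    (c := fun U : 𝒰 => σ ⁻¹' U.1) isCompact_univ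
    (fun U => (hopen U.1 U.2).preimage σ.continuous) (fun t _ => by
      obtain ⟨U, hU, ht⟩ := Set.mem_sUnion.1 (hcov ▸ Set.mem_univ (σ t))
      exact Set.mem_iUnion.2 ⟨⟨U, hU⟩, ht⟩)
  obtain ⟨N, hN⟩ := exists_subdiv_iterate_diam (k := k) n (half_pos hε)
    (stdSimplex.vertex : Fin (n + 1) → stdSimplex ℝ (Fin (n + 1)))
  refine ⟨N, ?_⟩
  have hpush : ∀ M : ℕ, ∀ x, (singSubdiv n)^[M] (push σ n x) =
      push σ n ((OrdChain.subdiv (k := k) bary (n + 1))^[M] x) := fun M x =>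
    (Function.Semiconj.iterate_right (f := push σ n) (fun y => (singSubdiv_push σ n y).symm) M
      x).symm
  rw [← push_vertex, hpush]
  refine OrdChain.map_mem_of_supported _ _ _ (fun v hv => ?_) hN
  obtain ⟨U, hU⟩ := hball (v 0) (Set.mem_univ _)
  rw [push_single]
  refine singChain_mem_smallChains U.2 ?_
  rintro _ ⟨t, rfl⟩
  refine hU (Metric.mem_ball.2 (lt_of_le_of_lt (b := ε / 2) ?_ (half_lt_self hε)))
  exact dist_convexComb_le v t (v 0) fun i => (hv i 0).le

lemma exists_iterate_mem_smallChains (hopen : ∀ U ∈ 𝒰, IsOpen U) (hcov : ⋃₀ 𝒰 = Set.univ) {n : ℕ}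
    (c : ((chains k).obj X).X n) : ∃ N : ℕ, (singSubdiv n)^[N] c ∈ smallChains k 𝒰 n := by
  have hc : c ∈ Submodule.span k (Set.range (singChain k (X := X) (n := n))) := by
    rw [span_singChain]
    trivial
  induction hc using Submodule.span_induction with
  | mem c hc =>
    obtain ⟨σ, rfl⟩ := hc
    exact exists_iterate_singChain_mem hopen hcov σ
  | zero => exact ⟨0, Submodule.zero_mem _⟩
  | add a b _ _ ha hb =>
    obtain ⟨N, hN⟩ := ha
    obtain ⟨M, hM⟩ := hb
    refine ⟨N + M, ?_⟩
    rw [iterate_map_add]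
    refine Submodule.add_mem _ ?_ ?_
    · rw [Nat.add_comm, Function.iterate_add_apply]
      exact iterate_singSubdiv_mem_smallChains hN M
    · rw [Function.iterate_add_apply]
      exact iterate_singSubdiv_mem_smallChains hM N
  | smul r a _ ha =>
    obtain ⟨N, hN⟩ := ha
    refine ⟨N, ?_⟩
    have h : (singSubdiv n)^[N] (r • a) = r • (singSubdiv n)^[N] a :=
      (Function.Semiconj.iterate_right (f := (r • ·))
        (fun y => (map_smul (singSubdiv n) r y).symm) N a).symm
    rw [h]
    exact Submodule.smul_mem _ r hN

lemma sub_singSubdiv_mem {n : ℕ} (c : ((chains k).obj X).X n)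
    (hc : ∀ m, ((chains k).obj X).d n m c ∈ smallChains k 𝒰 m) :
    c - singSubdiv n c - ((chains k).obj X).d (n + 1) n (singHomotopy n c) ∈
      smallChains k 𝒰 n := by
  rcases n with _ | n
  · have : c - singSubdiv 0 c - ((chains k).obj X).d 1 0 (singHomotopy 0 c) = 0 := by
      rw [singSubdiv, sub_eq_zero]
      exact sub_sub_cancel _ _
    rw [this]
    exact Submodule.zero_mem _
  · have : c - singSubdiv (n + 1) c - ((chains k).obj X).d (n + 2) (n + 1)
        (singHomotopy (n + 1) c) = singHomotopy n (((chains k).obj X).d (n + 1) n c) := by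
      have h : singSubdiv (n + 1) c = c - ((chains k).obj X).d (n + 2) (n + 1)
        (singHomotopy (n + 1) c) - singHomotopy n (((chains k).obj X).d (n + 1) n c) := rfl
      rw [h]
      abel
    rw [this]
    exact singHomotopy_mem_smallChains (hc n)

/-- A chain whose boundary is small with respect to an open cover is small up to a boundary: the
quotient of the singular chains by the small chains is acyclic. -/
theorem exists_sub_d_mem_smallChains (hopen : ∀ U ∈ 𝒰, IsOpen U) (hcov : ⋃₀ 𝒰 = Set.univ) {n : ℕ}
    (c : ((chains k).obj X).X n)
    (hc : ∀ m, ((chains k).obj X).d n m c ∈ smallChains k 𝒰 m) :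
    ∃ e, c - ((chains k).obj X).d (n + 1) n e ∈ smallChains k 𝒰 n := by
  obtain ⟨N, hN⟩ := exists_iterate_mem_smallChains hopen hcov c
  induction N generalizing c with
  | zero => exact ⟨0, by simpa using hN⟩
  | succ N ih =>
    have hs := sub_singSubdiv_mem c hc
    obtain ⟨e, he⟩ := ih (singSubdiv n c) (fun m => by
      have h1 := d_mem_smallChains n m hs
      have h2 : ((chains k).obj X).d n m (((chains k).obj X).d (n + 1) n (singHomotopy n c)) = 0 :=
        ConcreteCategory.congr_hom (((chains k).obj X).d_comp_d (n + 1) n m) _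
      rw [map_sub, map_sub, h2, sub_zero] at h1
      simpa using Submodule.sub_mem _ (hc m) h1) hN
    refine ⟨e + singHomotopy n c, ?_⟩
    have := Submodule.add_mem _ he hs
    rw [map_add]
    convert this using 1
    abel

end Subdivision

/-! ### The small chains theorem -/

section QuasiIso

/-- A monomorphism of complexes of modules is a quasi-isomorphism if every chain of the target
whose boundary is in the image is, up to a boundary, in the image. -/
lemma quasiIso_of_mono_of_exists {R : Type*} [Ring R] {K L : ChainComplex (ModuleCat R) ℕ}
    (f : K ⟶ L) [Mono f]
    (h : ∀ (n : ℕ) (c : L.X n), (∀ m, L.d n m c ∈ (f.f m).hom.range) →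
      ∃ e, c - L.d (n + 1) n e ∈ (f.f n).hom.range) : QuasiIso f := by
  let S : ShortComplex (ChainComplex (ModuleCat R) ℕ) :=
    ShortComplex.mk f (cokernel.π f) (cokernel.condition f)
  have hS : S.ShortExact :=
    { exact := ShortComplex.exact_cokernel f
      mono_f := inferInstanceAs (Mono f)
      epi_g := inferInstanceAs (Epi (cokernel.π f)) }
  have hdeg (m : ℕ) : (S.map (HomologicalComplex.eval _ _ m)).ShortExact :=
    hS.map_of_exact (HomologicalComplex.eval _ _ m)
  have hQ (n : ℕ) : (cokernel f).ExactAt n := by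
    rw [HomologicalComplex.exactAt_iff' _ (n + 1) n _ (by simp) rfl,
      ShortComplex.moduleCat_exact_iff]
    intro z hz
    have hsurj : Function.Surjective ((cokernel.π f).f n) := (hdeg n).moduleCat_surjective_g
    obtain ⟨c, rfl⟩ := hsurj z
    have hcomm (i j : ℕ) (y : L.X i) : (cokernel f).d i j ((cokernel.π f).f i y) =
        (cokernel.π f).f j (L.d i j y) :=
      ConcreteCategory.congr_hom ((cokernel.π f).comm i j) y
    obtain ⟨e, b, he⟩ := h n c fun m => by
      have h0 : (cokernel f).d n m ((cokernel.π f).f n c) = 0 := by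
        by_cases hm : (ComplexShape.down ℕ).Rel n m
        · obtain rfl := (ComplexShape.down ℕ).next_eq' hm
          exact hz
        · rw [(cokernel f).shape n m hm]
          rfl
      rw [hcomm] at h0
      exact ((ShortComplex.moduleCat_exact_iff _).1 (hdeg m).exact) _ h0
    refine ⟨(cokernel.π f).f (n + 1) e, ?_⟩
    have hb : (cokernel.π f).f n (f.f n b) = 0 :=
      (S.map (HomologicalComplex.eval _ _ n)).moduleCat_zero_apply b
    have he' : f.f n b = c - L.d (n + 1) n e := he
    rw [he', map_sub, sub_eq_zero] at hb
    exact (hcomm (n + 1) n e).trans hb.symm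
  have hz (n : ℕ) : IsZero (S.X₃.homology n) := (hQ n).isZero_homology
  refine ⟨fun n => (quasiIsoAt_iff_isIso_homologyMap f n).2 ?_⟩
  have hepi : Epi (HomologicalComplex.homologyMap f n) :=
    (hS.homology_exact₂ n).epi_f ((hz n).eq_of_tgt _ _)
  have hmono : Mono (HomologicalComplex.homologyMap f n) :=
    (hS.homology_exact₁ (n + 1) n rfl).mono_g ((hz (n + 1)).eq_of_src _ _)
  exact isIso_of_mono_of_epi _

end QuasiIso

section TwoSets

variable (k : Type u) [Field k] {X : TopCat.{w}} {A U V W : Set X}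

open scoped Classical in
/-- The projection `C(W) ⟶ C(U)` for `U ⊆ W` that keeps the singular simplices contained in `U` and
kills the others. It is not a morphism of complexes. -/
def chainsProj (W U : Set X) (n : ℕ) :
    ((chains k).obj (TopCat.of W)).X n ⟶ ((chains k).obj (TopCat.of U)).X n :=
  chainsLift fun σ : C(stdSimplex ℝ (Fin (n + 1)), W) =>
    if h : ∀ t, (σ t).1 ∈ U then
      singChain (X := TopCat.of U) k ⟨fun t => ⟨(σ t).1, h t⟩, by fun_prop⟩
    else 0

lemma chainsProj_of_mem {n : ℕ} (σ : C(stdSimplex ℝ (Fin (n + 1)), TopCat.of W))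
    (h : ∀ t, (σ t).1 ∈ U) :
    chainsProj k W U n (singChain k σ) =
      singChain (X := TopCat.of U) k ⟨fun t => ⟨(σ t).1, h t⟩, by fun_prop⟩ := by
  refine (chainsLift_singChain _ σ).trans ?_
  rw [dif_pos h]

lemma chainsProj_of_not_mem {n : ℕ} (σ : C(stdSimplex ℝ (Fin (n + 1)), TopCat.of W))
    (h : ¬ ∀ t, (σ t).1 ∈ U) : chainsProj k W U n (singChain k σ) = 0 := by
  refine (chainsLift_singChain _ σ).trans ?_
  rw [dif_neg h]

lemma inclusion_chainsProj (hU : U ⊆ W) (n : ℕ) :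
    ((chains k).map (inclusion hU)).f n ≫ chainsProj k W U n = 𝟙 _ := by
  refine chains_hom_ext fun σ => ?_
  refine (congrArg (chainsProj k W U n) (chainsMap_singChain _ σ)).trans ?_
  exact chainsProj_of_mem k ((inclusion hU).hom.comp σ) (fun t => (σ t).2)

/-- A simplex of `V` lies in `U` if and only if it lies in `A = U ∩ V`. -/
lemma inclusion_chainsProj_inter (hA : A = U ∩ V) (hV : V ⊆ W) (n : ℕ) :
    ((chains k).map (inclusion hV)).f n ≫ chainsProj k W U n =
      chainsProj k V A n ≫
        ((chains k).map (inclusion (hA.le.trans Set.inter_subset_left))).f n := by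
  refine chains_hom_ext fun σ => ?_
  refine (congrArg (chainsProj k W U n) (chainsMap_singChain _ σ)).trans ?_
  refine Eq.trans ?_ (ConcreteCategory.comp_apply (chainsProj k V A n) _ _).symm
  by_cases h : ∀ t, (σ t).1 ∈ U
  · have hA' : ∀ t, (σ t).1 ∈ A := fun t => hA.ge ⟨h t, (σ t).2⟩
    refine (chainsProj_of_mem k ((inclusion hV).hom.comp σ) h).trans (Eq.trans ?_
      (congrArg _ (chainsProj_of_mem k σ hA')).symm)
    exact (chainsMap_singChain (inclusion (hA.le.trans Set.inter_subset_left))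
      (X := TopCat.of A) ⟨fun t => ⟨(σ t).1, hA' t⟩, by fun_prop⟩).symm
  · refine (chainsProj_of_not_mem k ((inclusion hV).hom.comp σ) h).trans (Eq.trans ?_
      (congrArg _ (chainsProj_of_not_mem k σ
        (fun h' => h fun t => (hA.le (h' t)).1))).symm)
    exact (map_zero (((chains k).map
      (inclusion (hA.le.trans Set.inter_subset_left))).f n).hom).symm

variable (hA : A = U ∩ V) (hW : W = U ∪ V)

lemma sumToUnion_apply (n : ℕ)
    (x : ((chains k).obj (TopCat.of U) ⊞ (chains k).obj (TopCat.of V)).X n) :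
    (sumToUnion k hW).f n x =
      ((chains k).map (inclusion (Set.subset_union_left.trans hW.ge))).f n
        ((biprod.fst : (chains k).obj (TopCat.of U) ⊞ (chains k).obj (TopCat.of V) ⟶ _).f n x) +
      ((chains k).map (inclusion (Set.subset_union_right.trans hW.ge))).f n
        ((biprod.snd : (chains k).obj (TopCat.of U) ⊞ (chains k).obj (TopCat.of V) ⟶ _).f n x) := by
  rw [sumToUnion, biprod.desc_eq]
  rfl

/-- Exactness of `C(U ∩ V) ⟶ C(U) ⊕ C(V) ⟶ C(U ∪ V)`, which makes `smallChainsMap` injective. -/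
lemma exists_interToSum_eq (n : ℕ)
    (x : ((chains k).obj (TopCat.of U) ⊞ (chains k).obj (TopCat.of V)).X n)
    (hx : (sumToUnion k hW).f n x = 0) : ∃ c, (interToSum k hA).f n c = x := by
  have hUW : U ⊆ W := Set.subset_union_left.trans hW.ge
  have hVW : V ⊆ W := Set.subset_union_right.trans hW.ge
  have hAU : A ⊆ U := hA.le.trans Set.inter_subset_left
  have hAV : A ⊆ V := hA.le.trans Set.inter_subset_right
  set a := (biprod.fst : (chains k).obj (TopCat.of U) ⊞ (chains k).obj (TopCat.of V) ⟶ _).f n x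
    with ha
  set b := (biprod.snd : (chains k).obj (TopCat.of U) ⊞ (chains k).obj (TopCat.of V) ⟶ _).f n x
    with hb
  have hab : ((chains k).map (inclusion hUW)).f n a = -((chains k).map (inclusion hVW)).f n b :=
    eq_neg_of_add_eq_zero_left ((sumToUnion_apply k hW n x).symm.trans hx)
  -- Since `a = -b` in `C(W)`, projecting to `C(U)` shows that `a` is minus the part of `b` that is
  -- carried by `A`.
  set c := -(chainsProj k V A n b) with hc
  have hca : ((chains k).map (inclusion hAU)).f n c = a := by
    have h1 := ConcreteCategory.congr_hom (inclusion_chainsProj k hUW n) a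
    have h2 := ConcreteCategory.congr_hom (inclusion_chainsProj_inter k hA hVW n) b
    rw [ConcreteCategory.comp_apply] at h1 h2
    rw [hab, map_neg, h2, ConcreteCategory.comp_apply] at h1
    rw [hc, map_neg]
    exact h1
  have hcb : -((chains k).map (inclusion hAV)).f n c = b := by
    have hinj : Function.Injective (((chains k).map (inclusion hVW)).f n) := fun y z hyz => by
      have h := congrArg (chainsProj k W V n) hyz
      have h1 := ConcreteCategory.congr_hom (inclusion_chainsProj k hVW n) y
      have h2 := ConcreteCategory.congr_hom (inclusion_chainsProj k hVW n) z
      exact h1.symm.trans (h.trans h2)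
    apply hinj
    have hcomm : ((chains k).map (inclusion hVW)).f n (((chains k).map (inclusion hAV)).f n c) =
        ((chains k).map (inclusion hUW)).f n (((chains k).map (inclusion hAU)).f n c) := by
      have h : inclusion hAV ≫ inclusion hVW = inclusion hAU ≫ inclusion hUW := rfl
      have h' := congrArg (fun g => ((chains k).map g).f n) h
      simp only [Functor.map_comp, HomologicalComplex.comp_f] at h'
      exact ConcreteCategory.congr_hom h' c
    rw [map_neg, hcomm, hca, hab, neg_neg]
  have hfst : (interToSum k hA).f n ≫ (biprod.fst : (chains k).obj (TopCat.of U) ⊞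
      (chains k).obj (TopCat.of V) ⟶ _).f n = ((chains k).map (inclusion hAU)).f n := by
    rw [← HomologicalComplex.comp_f, interToSum, biprod.lift_fst]
  have hsnd : (interToSum k hA).f n ≫ (biprod.snd : (chains k).obj (TopCat.of U) ⊞
      (chains k).obj (TopCat.of V) ⟶ _).f n = -((chains k).map (inclusion hAV)).f n := by
    rw [← HomologicalComplex.comp_f, interToSum, biprod.lift_snd]
    rfl
  have htot := congrArg (fun g => g.f n) (biprod.total
    (X := (chains k).obj (TopCat.of U)) (Y := (chains k).obj (TopCat.of V)))
  have hext (y z : ((chains k).obj (TopCat.of U) ⊞ (chains k).obj (TopCat.of V)).X n)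
      (h1 : (biprod.fst : (chains k).obj (TopCat.of U) ⊞
        (chains k).obj (TopCat.of V) ⟶ _).f n y = (biprod.fst : (chains k).obj (TopCat.of U) ⊞
        (chains k).obj (TopCat.of V) ⟶ _).f n z)
      (h2 : (biprod.snd : (chains k).obj (TopCat.of U) ⊞
        (chains k).obj (TopCat.of V) ⟶ _).f n y = (biprod.snd : (chains k).obj (TopCat.of U) ⊞
        (chains k).obj (TopCat.of V) ⟶ _).f n z) : y = z := by
    have hy := ConcreteCategory.congr_hom htot y
    have hz := ConcreteCategory.congr_hom htot z
    refine hy.symm.trans (Eq.trans ?_ hz)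
    exact congrArg₂ (· + ·) (congrArg ((biprod.inl : _ ⟶ (chains k).obj (TopCat.of U) ⊞
      (chains k).obj (TopCat.of V)).f n) h1) (congrArg ((biprod.inr : _ ⟶
      (chains k).obj (TopCat.of U) ⊞ (chains k).obj (TopCat.of V)).f n) h2)
  refine ⟨c, hext _ _ ?_ ?_⟩
  · exact (ConcreteCategory.congr_hom hfst c).trans hca
  · exact (ConcreteCategory.congr_hom hsnd c).trans hcb

lemma π_smallChainsMap (n : ℕ)
    (x : ((chains k).obj (TopCat.of U) ⊞ (chains k).obj (TopCat.of V)).X n) :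
    (smallChainsMap k hA hW).f n ((mvShortComplex k hA).g.f n x) = (sumToUnion k hW).f n x :=
  ConcreteCategory.congr_hom (congrArg (fun g => g.f n)
    (cokernel.π_desc (interToSum k hA) (sumToUnion k hW) (interToSum_sumToUnion k hA hW))) x

lemma mvShortComplex_g_surjective (n : ℕ) :
    Function.Surjective ((mvShortComplex k hA).g.f n) :=
  ((mvShortComplex_shortExact k hA).map_of_exact
    (HomologicalComplex.eval _ _ n)).moduleCat_surjective_g

instance : Mono (smallChainsMap k hA hW) := by
  refine HomologicalComplex.mono_of_mono_f _ fun n => ?_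
  rw [ModuleCat.mono_iff_injective]
  refine (injective_iff_map_eq_zero _).2 fun y hy => ?_
  obtain ⟨x, rfl⟩ := mvShortComplex_g_surjective k hA n y
  obtain ⟨c, rfl⟩ := exists_interToSum_eq k hA hW n x ((π_smallChainsMap k hA hW n x).symm.trans hy)
  exact ((mvShortComplex k hA).map (HomologicalComplex.eval _ _ n)).moduleCat_zero_apply c

/-- The traces on `W` of the sets `U` and `V`. -/
abbrev traces (W U V : Set X) : Set (Set W) := {Subtype.val ⁻¹' U, Subtype.val ⁻¹' V}

/-- The image of `C(U) + C(V)` in `C(W)` consists of the chains that are small with respect to the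
cover. -/
lemma range_smallChainsMap (n : ℕ) :
    ((smallChainsMap k hA hW).f n).hom.range =
      smallChains (X := TopCat.of W) k (traces W U V) n := by
  have hUW : U ⊆ W := Set.subset_union_left.trans hW.ge
  have hVW : V ⊆ W := Set.subset_union_right.trans hW.ge
  refine le_antisymm ?_ (Submodule.span_le.2 ?_)
  · have key (Z : Set X) (hZ : Z ⊆ W) (hZ' : Subtype.val ⁻¹' Z ∈ traces W U V)
        (a : ((chains k).obj (TopCat.of Z)).X n) :
        ((chains k).map (inclusion hZ)).f n a ∈
          smallChains (X := TopCat.of W) k (traces W U V) n := by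
      have ha : a ∈ Submodule.span k (Set.range (singChain k)) := by
        rw [span_singChain]
        trivial
      induction ha using Submodule.span_induction with
      | mem a ha =>
        obtain ⟨σ, rfl⟩ := ha
        rw [chainsMap_singChain]
        refine singChain_mem_smallChains hZ' ?_
        rintro _ ⟨t, rfl⟩
        exact (σ t).2
      | zero => rw [map_zero]; exact Submodule.zero_mem _
      | add a b _ _ ha hb => rw [map_add]; exact Submodule.add_mem _ ha hb
      | smul r a _ ha => rw [map_smul]; exact Submodule.smul_mem _ r ha
    rintro _ ⟨y, rfl⟩
    obtain ⟨x, rfl⟩ := mvShortComplex_g_surjective k hA n y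
    refine Set.mem_of_eq_of_mem ((π_smallChainsMap k hA hW n x).trans
      (sumToUnion_apply k hW n x)) ?_
    exact Submodule.add_mem _ (key U hUW (Or.inl rfl) _) (key V hVW (Or.inr rfl) _)
  · rintro _ ⟨σ, ⟨Z, hZ, hσ⟩, rfl⟩
    have hmem : ∀ t, σ t ∈ Z := fun t => hσ ⟨t, rfl⟩
    rcases hZ with rfl | rfl
    · refine ⟨(mvShortComplex k hA).g.f n ((biprod.inl : _ ⟶ (chains k).obj (TopCat.of U) ⊞
        (chains k).obj (TopCat.of V)).f n (singChain k ⟨fun t => ⟨(σ t).1, hmem t⟩, by fun_prop⟩)),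
        ?_⟩
      refine (π_smallChainsMap k hA hW n _).trans ?_
      refine (ConcreteCategory.congr_hom (congrArg (fun g => g.f n) (biprod.inl_desc
        ((chains k).map (inclusion hUW)) ((chains k).map (inclusion hVW)))) _).trans ?_
      exact chainsMap_singChain _ _
    · refine ⟨(mvShortComplex k hA).g.f n ((biprod.inr : _ ⟶ (chains k).obj (TopCat.of U) ⊞
        (chains k).obj (TopCat.of V)).f n (singChain k ⟨fun t => ⟨(σ t).1, hmem t⟩, by fun_prop⟩)),
        ?_⟩
      refine (π_smallChainsMap k hA hW n _).trans ?_
      refine (ConcreteCategory.congr_hom (congrArg (fun g => g.f n) (biprod.inr_desc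
        ((chains k).map (inclusion hUW)) ((chains k).map (inclusion hVW)))) _).trans ?_
      exact chainsMap_singChain _ _

/-- The small chains theorem for a cover by two open sets. -/
theorem quasiIso_smallChainsMap (hU : IsOpen U) (hV : IsOpen V) :
    QuasiIso (smallChainsMap k hA hW) := by
  refine quasiIso_of_mono_of_exists _ fun n c hc => ?_
  rw [range_smallChainsMap]
  refine exists_sub_d_mem_smallChains ?_ ?_ c fun m => ?_
  · rintro Z (rfl | rfl)
    · exact hU.preimage continuous_subtype_val
    · exact hV.preimage continuous_subtype_val
  · rw [Set.sUnion_pair, ← Set.preimage_union, ← hW]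
    exact Subtype.coe_preimage_self W
  · rw [← range_smallChainsMap k hA hW]
    exact hc m

end TwoSets

/-! ### The Mayer-Vietoris sequence -/

section MayerVietorisSequence

variable (k : Type u) [Field k] {X Y : TopCat.{w}} {A U V W : Set X} {A' U' V' W' : Set Y}

/-- `H_n(A) ⟶ H_n(U) ⊕ H_n(V)`, `c ↦ (c, -c)`. -/
def homologyInterToProd (hAU : A ⊆ U) (hAV : A ⊆ V) (n : ℕ) :
    ((chains k).obj (TopCat.of A)).homology n →ₗ[k]
      ((chains k).obj (TopCat.of U)).homology n × ((chains k).obj (TopCat.of V)).homology n :=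
  LinearMap.prod (HomologicalComplex.homologyMap ((chains k).map (inclusion hAU)) n).hom
    (-(HomologicalComplex.homologyMap ((chains k).map (inclusion hAV)) n).hom)

/-- `H_n(U) ⊕ H_n(V) ⟶ H_n(W)`, `(a, b) ↦ a + b`. -/
def homologyProdToUnion (hUW : U ⊆ W) (hVW : V ⊆ W) (n : ℕ) :
    ((chains k).obj (TopCat.of U)).homology n × ((chains k).obj (TopCat.of V)).homology n →ₗ[k]
      ((chains k).obj (TopCat.of W)).homology n :=
  LinearMap.coprod (HomologicalComplex.homologyMap ((chains k).map (inclusion hUW)) n).hom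
    (HomologicalComplex.homologyMap ((chains k).map (inclusion hVW)) n).hom

/-- Homology commutes with direct sums of two complexes. -/
def homologyBiprodEquiv {R : Type*} [Ring R] (K L : ChainComplex (ModuleCat R) ℕ) (n : ℕ) :
    (K ⊞ L).homology n ≃ₗ[R] K.homology n × L.homology n :=
  LinearEquiv.ofLinearMap
    (LinearMap.prod (HomologicalComplex.homologyMap (biprod.fst : K ⊞ L ⟶ K) n).hom
      (HomologicalComplex.homologyMap (biprod.snd : K ⊞ L ⟶ L) n).hom)
    (LinearMap.coprod (HomologicalComplex.homologyMap (biprod.inl : K ⟶ K ⊞ L) n).hom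
      (HomologicalComplex.homologyMap (biprod.inr : L ⟶ K ⊞ L) n).hom)
    (by
      have h1 : (HomologicalComplex.homologyMap (biprod.fst : K ⊞ L ⟶ K) n).hom ∘ₗ
          (HomologicalComplex.homologyMap (biprod.inl : K ⟶ K ⊞ L) n).hom = LinearMap.id := by
        rw [← ModuleCat.hom_comp, ← HomologicalComplex.homologyMap_comp, biprod.inl_fst,
          HomologicalComplex.homologyMap_id, ModuleCat.hom_id]
      have h2 : (HomologicalComplex.homologyMap (biprod.snd : K ⊞ L ⟶ L) n).hom ∘ₗ
          (HomologicalComplex.homologyMap (biprod.inl : K ⟶ K ⊞ L) n).hom = 0 := by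
        rw [← ModuleCat.hom_comp, ← HomologicalComplex.homologyMap_comp, biprod.inl_snd,
          HomologicalComplex.homologyMap_zero, ModuleCat.hom_zero]
      have h3 : (HomologicalComplex.homologyMap (biprod.fst : K ⊞ L ⟶ K) n).hom ∘ₗ
          (HomologicalComplex.homologyMap (biprod.inr : L ⟶ K ⊞ L) n).hom = 0 := by
        rw [← ModuleCat.hom_comp, ← HomologicalComplex.homologyMap_comp, biprod.inr_fst,
          HomologicalComplex.homologyMap_zero, ModuleCat.hom_zero]
      have h4 : (HomologicalComplex.homologyMap (biprod.snd : K ⊞ L ⟶ L) n).hom ∘ₗ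
          (HomologicalComplex.homologyMap (biprod.inr : L ⟶ K ⊞ L) n).hom = LinearMap.id := by
        rw [← ModuleCat.hom_comp, ← HomologicalComplex.homologyMap_comp, biprod.inr_snd,
          HomologicalComplex.homologyMap_id, ModuleCat.hom_id]
      rw [LinearMap.comp_coprod, LinearMap.prod_comp, LinearMap.prod_comp, h1, h2, h3, h4]
      ext <;> simp)
    (by
      have h := congrArg (fun g : K ⊞ L ⟶ K ⊞ L => (HomologicalComplex.homologyMap g n).hom)
        (biprod.total (X := K) (Y := L))
      simp only [HomologicalComplex.homologyMap_add, HomologicalComplex.homologyMap_comp,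
        HomologicalComplex.homologyMap_id, ModuleCat.hom_add, ModuleCat.hom_comp,
        ModuleCat.hom_id] at h
      rw [LinearMap.coprod_comp_prod]
      exact h)

variable (hA : A = U ∩ V) (hW : W = U ∪ V)

lemma homologyBiprodEquiv_interToSum (n : ℕ)
    (a : ((chains k).obj (TopCat.of A)).homology n) :
    homologyBiprodEquiv _ _ n (HomologicalComplex.homologyMap (interToSum k hA) n a) =
      homologyInterToProd k (hA.le.trans Set.inter_subset_left)
        (hA.le.trans Set.inter_subset_right) n a := by
  refine Prod.ext ?_ ?_
  · change HomologicalComplex.homologyMap (biprod.fst : (chains k).obj (TopCat.of U) ⊞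
      (chains k).obj (TopCat.of V) ⟶ _) n
      (HomologicalComplex.homologyMap (interToSum k hA) n a) = _
    rw [← ConcreteCategory.comp_apply, ← HomologicalComplex.homologyMap_comp, interToSum,
      biprod.lift_fst]
    rfl
  · change HomologicalComplex.homologyMap (biprod.snd : (chains k).obj (TopCat.of U) ⊞
      (chains k).obj (TopCat.of V) ⟶ _) n
      (HomologicalComplex.homologyMap (interToSum k hA) n a) = _
    rw [← ConcreteCategory.comp_apply, ← HomologicalComplex.homologyMap_comp, interToSum,
      biprod.lift_snd, HomologicalComplex.homologyMap_neg]
    rfl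

lemma homologyProdToUnion_biprodEquiv (n : ℕ)
    (y : ((chains k).obj (TopCat.of U) ⊞ (chains k).obj (TopCat.of V)).homology n) :
    homologyProdToUnion k (Set.subset_union_left.trans hW.ge)
      (Set.subset_union_right.trans hW.ge) n (homologyBiprodEquiv _ _ n y) =
      HomologicalComplex.homologyMap (sumToUnion k hW) n y := by
  rw [sumToUnion, biprod.desc_eq, HomologicalComplex.homologyMap_add,
    HomologicalComplex.homologyMap_comp, HomologicalComplex.homologyMap_comp]
  rfl

lemma homologyMap_sumToUnion (n : ℕ)
    (y : ((chains k).obj (TopCat.of U) ⊞ (chains k).obj (TopCat.of V)).homology n) :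
    HomologicalComplex.homologyMap (sumToUnion k hW) n y =
      HomologicalComplex.homologyMap (smallChainsMap k hA hW) n
        (HomologicalComplex.homologyMap (mvShortComplex k hA).g n y) := by
  have h : sumToUnion k hW = (mvShortComplex k hA).g ≫ smallChainsMap k hA hW :=
    (cokernel.π_desc _ _ (interToSum_sumToUnion k hA hW)).symm
  have h' : HomologicalComplex.homologyMap (sumToUnion k hW) n =
      HomologicalComplex.homologyMap (mvShortComplex k hA).g n ≫
        HomologicalComplex.homologyMap (smallChainsMap k hA hW) n :=
    (congrArg (HomologicalComplex.homologyMap · n) h).trans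
      (HomologicalComplex.homologyMap_comp _ _ n)
  exact ConcreteCategory.congr_hom h' y

variable [hq : QuasiIso (smallChainsMap k hA hW)]

lemma homologyMap_smallChainsMap_bijective (n : ℕ) :
    Function.Bijective (HomologicalComplex.homologyMap (smallChainsMap k hA hW) n) :=
  ConcreteCategory.bijective_of_isIso _

lemma homologyMap_smallChainsMap_mvConnectingNat (n : ℕ) :
    HomologicalComplex.homologyMap (smallChainsMap k hA hW) (n + 1) ≫ mvConnectingNat k hA hW n =
      (mvShortComplex_shortExact k hA).δ (n + 1) n rfl := by
  have h : IsIso (HomologicalComplex.homologyMap (smallChainsMap k hA hW) (n + 1)) :=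
    inferInstance
  rw [mvConnectingNat, dif_pos h]
  exact IsIso.hom_inv_id_assoc _ _

lemma mvConnectingNat_apply (n : ℕ) (z : (mvShortComplex k hA).X₃.homology (n + 1)) :
    mvConnectingNat k hA hW n
      (HomologicalComplex.homologyMap (smallChainsMap k hA hW) (n + 1) z) =
      (mvShortComplex_shortExact k hA).δ (n + 1) n rfl z :=
  ConcreteCategory.congr_hom (homologyMap_smallChainsMap_mvConnectingNat k hA hW n) z

lemma exact_mvConnectingNat_interToProd (n : ℕ) :
    Function.Exact (mvConnectingNat k hA hW n).hom
      (homologyInterToProd k (hA.le.trans Set.inter_subset_left)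
        (hA.le.trans Set.inter_subset_right) n) := by
  have hex : Function.Exact ((mvShortComplex_shortExact k hA).δ (n + 1) n rfl)
      (HomologicalComplex.homologyMap (interToSum k hA) n) :=
    (ShortComplex.ShortExact.moduleCat_exact_iff_function_exact _).1
      ((mvShortComplex_shortExact k hA).homology_exact₁ (n + 1) n rfl)
  intro a
  rw [← homologyBiprodEquiv_interToSum k hA, LinearEquiv.map_eq_zero_iff]
  refine (hex a).trans ⟨?_, ?_⟩
  · rintro ⟨z, rfl⟩
    exact ⟨_, mvConnectingNat_apply k hA hW n z⟩
  · rintro ⟨c, rfl⟩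
    obtain ⟨z, rfl⟩ := (homologyMap_smallChainsMap_bijective k hA hW (n + 1)).2 c
    exact ⟨z, (mvConnectingNat_apply k hA hW n z).symm⟩

lemma exact_interToProd_prodToUnion (n : ℕ) :
    Function.Exact (homologyInterToProd k (hA.le.trans Set.inter_subset_left)
        (hA.le.trans Set.inter_subset_right) n)
      (homologyProdToUnion k (Set.subset_union_left.trans hW.ge)
        (Set.subset_union_right.trans hW.ge) n) := by
  have hex : Function.Exact (HomologicalComplex.homologyMap (interToSum k hA) n)
      (HomologicalComplex.homologyMap (mvShortComplex k hA).g n) :=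
    (ShortComplex.ShortExact.moduleCat_exact_iff_function_exact _).1
      ((mvShortComplex_shortExact k hA).homology_exact₂ n)
  intro p
  obtain ⟨y, rfl⟩ := (homologyBiprodEquiv _ _ n).surjective p
  rw [homologyProdToUnion_biprodEquiv k hW, homologyMap_sumToUnion k hA hW]
  refine (map_eq_zero_iff _ (homologyMap_smallChainsMap_bijective k hA hW n).1).trans ?_
  refine (hex y).trans ⟨?_, ?_⟩
  · rintro ⟨a, rfl⟩
    exact ⟨a, (homologyBiprodEquiv_interToSum k hA n a).symm⟩
  · rintro ⟨a, ha⟩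
    rw [← homologyBiprodEquiv_interToSum k hA] at ha
    exact ⟨a, (homologyBiprodEquiv _ _ n).injective ha⟩

lemma exact_prodToUnion_mvConnectingNat (n : ℕ) :
    Function.Exact (homologyProdToUnion k (Set.subset_union_left.trans hW.ge)
        (Set.subset_union_right.trans hW.ge) (n + 1)) (mvConnectingNat k hA hW n).hom := by
  have hex : Function.Exact (HomologicalComplex.homologyMap (mvShortComplex k hA).g (n + 1))
      ((mvShortComplex_shortExact k hA).δ (n + 1) n rfl) :=
    (ShortComplex.ShortExact.moduleCat_exact_iff_function_exact _).1
      ((mvShortComplex_shortExact k hA).homology_exact₃ (n + 1) n rfl)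
  intro c
  obtain ⟨z, rfl⟩ := (homologyMap_smallChainsMap_bijective k hA hW (n + 1)).2 c
  refine (Eq.congr_left (mvConnectingNat_apply k hA hW n z)).trans ((hex z).trans ⟨?_, ?_⟩)
  · rintro ⟨y, rfl⟩
    refine ⟨homologyBiprodEquiv _ _ (n + 1) y, ?_⟩
    exact (homologyProdToUnion_biprodEquiv k hW (n + 1) y).trans
      (homologyMap_sumToUnion k hA hW (n + 1) y)
  · rintro ⟨p, hp⟩
    obtain ⟨y, rfl⟩ := (homologyBiprodEquiv _ _ (n + 1)).surjective p
    rw [homologyProdToUnion_biprodEquiv k hW, homologyMap_sumToUnion k hA hW] at hp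
    exact ⟨y, (homologyMap_smallChainsMap_bijective k hA hW (n + 1)).1 hp⟩

/-- The end of the Mayer-Vietoris sequence: `H_0(U) ⊕ H_0(V) ⟶ H_0(U ∪ V)` is surjective. -/
lemma prodToUnion_zero_surjective (hA : A = U ∩ V) (hW : W = U ∪ V)
    [QuasiIso (smallChainsMap k hA hW)] :
    Function.Surjective (homologyProdToUnion k (Set.subset_union_left.trans hW.ge)
        (Set.subset_union_right.trans hW.ge) 0) := by
  intro c
  obtain ⟨z, rfl⟩ := (homologyMap_smallChainsMap_bijective k hA hW 0).2 c
  have hepi : Epi ((mvShortComplex k hA).g.f 0) :=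
    (ModuleCat.epi_iff_surjective _).2 (mvShortComplex_g_surjective k hA 0)
  have h := HomologicalComplex.epi_homologyMap_of_epi_of_not_rel (mvShortComplex k hA).g 0
    (by simp)
  obtain ⟨y, rfl⟩ := (ModuleCat.epi_iff_surjective _).1 h z
  refine ⟨homologyBiprodEquiv _ _ 0 y, ?_⟩
  exact (homologyProdToUnion_biprodEquiv k hW 0 y).trans (homologyMap_sumToUnion k hA hW 0 y)

variable (hA' : A' = U' ∩ V') (hW' : W' = U' ∪ V') [hq' : QuasiIso (smallChainsMap k hA' hW')]

/-- The Mayer-Vietoris connecting homomorphism is natural with respect to maps of covers. -/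
lemma mvConnectingNat_naturality
    (α : TopCat.of A ⟶ TopCat.of A') (υ : TopCat.of U ⟶ TopCat.of U')
    (ν : TopCat.of V ⟶ TopCat.of V') (ω : TopCat.of W ⟶ TopCat.of W')
    (hαυ : α ≫ inclusion (hA'.le.trans Set.inter_subset_left) =
      inclusion (hA.le.trans Set.inter_subset_left) ≫ υ)
    (hαν : α ≫ inclusion (hA'.le.trans Set.inter_subset_right) =
      inclusion (hA.le.trans Set.inter_subset_right) ≫ ν)
    (hυω : υ ≫ inclusion (Set.subset_union_left.trans hW'.ge) =
      inclusion (Set.subset_union_left.trans hW.ge) ≫ ω)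
    (hνω : ν ≫ inclusion (Set.subset_union_right.trans hW'.ge) =
      inclusion (Set.subset_union_right.trans hW.ge) ≫ ω) (n : ℕ) :
    HomologicalComplex.homologyMap ((chains k).map ω) (n + 1) ≫ mvConnectingNat k hA' hW' n =
      mvConnectingNat k hA hW n ≫ HomologicalComplex.homologyMap ((chains k).map α) n := by
  have h12 : (chains k).map α ≫ interToSum k hA' =
      interToSum k hA ≫ biprod.map ((chains k).map υ) ((chains k).map ν) := by
    rw [interToSum, interToSum]
    refine biprod.hom_ext _ _ ?_ ?_
    · rw [Category.assoc, Category.assoc, biprod.lift_fst, biprod.map_fst, biprod.lift_fst_assoc,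
        ← Functor.map_comp, ← Functor.map_comp, hαυ]
    · rw [Category.assoc, Category.assoc, biprod.lift_snd, biprod.map_snd, biprod.lift_snd_assoc,
        Preadditive.comp_neg, Preadditive.neg_comp, ← Functor.map_comp, ← Functor.map_comp, hαν]
  have h23 : biprod.map ((chains k).map υ) ((chains k).map ν) ≫ sumToUnion k hW' =
      sumToUnion k hW ≫ (chains k).map ω := by
    rw [sumToUnion, sumToUnion]
    refine biprod.hom_ext' _ _ ?_ ?_
    · rw [biprod.inl_map_assoc, biprod.inl_desc, biprod.inl_desc_assoc, ← Functor.map_comp,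
        ← Functor.map_comp, hυω]
    · rw [biprod.inr_map_assoc, biprod.inr_desc, biprod.inr_desc_assoc, ← Functor.map_comp,
        ← Functor.map_comp, hνω]
  let φ : mvShortComplex k hA ⟶ mvShortComplex k hA' :=
    { τ₁ := (chains k).map α
      τ₂ := biprod.map ((chains k).map υ) ((chains k).map ν)
      τ₃ := cokernel.map (interToSum k hA) (interToSum k hA') _ _ h12.symm
      comm₁₂ := h12
      comm₂₃ := (cokernel.π_desc _ _ _).symm }
  have h3 : φ.τ₃ ≫ smallChainsMap k hA' hW' = smallChainsMap k hA hW ≫ (chains k).map ω := by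
    have : Epi (mvShortComplex k hA).g := (mvShortComplex_shortExact k hA).epi_g
    rw [← cancel_epi (mvShortComplex k hA).g, ← φ.comm₂₃_assoc]
    have h1 : (mvShortComplex k hA').g ≫ smallChainsMap k hA' hW' = sumToUnion k hW' :=
      cokernel.π_desc _ _ _
    have h2 : (mvShortComplex k hA).g ≫ smallChainsMap k hA hW = sumToUnion k hW :=
      cokernel.π_desc _ _ _
    rw [h1, reassoc_of% h2]
    exact h23
  have hδ := HomologicalComplex.HomologySequence.δ_naturality φ (mvShortComplex_shortExact k hA)
    (mvShortComplex_shortExact k hA') (n + 1) n rfl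
  rw [← cancel_epi (HomologicalComplex.homologyMap (smallChainsMap k hA hW) (n + 1)),
    ← Category.assoc, ← HomologicalComplex.homologyMap_comp, ← h3,
    HomologicalComplex.homologyMap_comp, Category.assoc,
    homologyMap_smallChainsMap_mvConnectingNat, ← Category.assoc,
    homologyMap_smallChainsMap_mvConnectingNat]
  exact hδ.symm

lemma mvConnecting_naturality
    (α : TopCat.of A ⟶ TopCat.of A') (υ : TopCat.of U ⟶ TopCat.of U')
    (ν : TopCat.of V ⟶ TopCat.of V') (ω : TopCat.of W ⟶ TopCat.of W')
    (hαυ : α ≫ inclusion (hA'.le.trans Set.inter_subset_left) =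
      inclusion (hA.le.trans Set.inter_subset_left) ≫ υ)
    (hαν : α ≫ inclusion (hA'.le.trans Set.inter_subset_right) =
      inclusion (hA.le.trans Set.inter_subset_right) ≫ ν)
    (hυω : υ ≫ inclusion (Set.subset_union_left.trans hW'.ge) =
      inclusion (Set.subset_union_left.trans hW.ge) ≫ ω)
    (hνω : ν ≫ inclusion (Set.subset_union_right.trans hW'.ge) =
      inclusion (Set.subset_union_right.trans hW.ge) ≫ ω) (i : ℤ) :
    (singularH.{u, w} k (i + 1)).map ω ≫ mvConnecting k hA' hW' i =
      mvConnecting k hA hW i ≫ (singularH.{u, w} k i).map α := by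
  rcases i with n | n
  · exact mvConnectingNat_naturality k hA hW hA' hW' α υ ν ω hαυ hαν hυω hνω n
  · rw [mvConnecting, mvConnecting, comp_zero, zero_comp]

end MayerVietorisSequence

/-! ### The Mayer-Vietoris system of level sets -/

section LevelSets

variable (k : Type u) [Field k]

lemma isOpen_levelSet (f : TopOverReal.{w}) (x : DeltaPlus) : IsOpen (levelSet f x) :=
  isOpen_Ioo.preimage f.fn.continuous

instance (f : TopOverReal.{w}) (s : PosVec) (x : DeltaPlus) :
    QuasiIso (levelSetSmallChainsMap.{u, w} k f s x) :=
  quasiIso_smallChainsMap k _ _ (isOpen_levelSet f _) (isOpen_levelSet f _)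

/-- The connecting morphism `M_{i+1}^f[s] ⟶ M_i^f` of persistence modules. -/
def levelSetδ (f : TopOverReal.{w}) (i : ℤ) (s : PosVec) :
    shift s.1 (levelSetModule.{u, w} k f (i + 1)) ⟶ levelSetModule.{u, w} k f i where
  app x := levelSetConnecting.{u, w} k f i s x
  naturality x y h :=
    mvConnecting_naturality k (levelSet_eq_inter f x s) (levelSet_eq_union f x s)
      (levelSet_eq_inter f y s) (levelSet_eq_union f y s)
      (inclusion (levelSet_mono f (leOfHom h)))
      (inclusion (levelSet_mono f (DeltaPlus.add_mono (leOfHom h) le_rfl)))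
      (inclusion (levelSet_mono f (DeltaPlus.add_mono (leOfHom h) le_rfl)))
      (inclusion (levelSet_mono f (DeltaPlus.add_mono (leOfHom h) le_rfl))) rfl rfl rfl rfl i

instance (f : TopOverReal.{w}) (n : ℕ) (x : DeltaPlus) :
    Subsingleton ((levelSetModule.{u, w} k f (Int.negSucc n)).obj x) :=
  inferInstanceAs (Subsingleton PUnit)

lemma fromShifts_surjective (f : TopOverReal.{w}) (s : PosVec) (x : DeltaPlus) (j : ℤ)
    (hj : j ≤ 0) : Function.Surjective (fromShifts (levelSetModule.{u, w} k f j) s x) := by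
  rcases j with n | n
  · obtain rfl : n = 0 := by
      have : (n : ℤ) ≤ 0 := hj
      lia
    exact prodToUnion_zero_surjective k (levelSet_eq_inter f x s) (levelSet_eq_union f x s)
  · intro c
    exact ⟨0, Subsingleton.elim _ _⟩

lemma isMVSystem_levelSet (f : TopOverReal.{w}) :
    IsMVSystem (levelSetModule.{u, w} k f) (levelSetδ.{u, w} k f) where
  exact_left i s x := by
    rcases i with n | n
    · exact exact_mvConnectingNat_interToProd k (levelSet_eq_inter f x s)
        (levelSet_eq_union f x s) n
    · intro a
      obtain rfl : a = 0 := Subsingleton.elim _ _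
      exact iff_of_true (map_zero _) ⟨0, map_zero _⟩
  exact_middle i s x := by
    rcases i with n | n
    · exact exact_interToProd_prodToUnion k (levelSet_eq_inter f x s)
        (levelSet_eq_union f x s) n
    · intro p
      obtain rfl : p = 0 := Subsingleton.elim _ _
      exact iff_of_true (map_zero _) ⟨0, map_zero _⟩
  exact_right i s x := by
    rcases i with n | n
    · exact exact_prodToUnion_mvConnectingNat k (levelSet_eq_inter f x s)
        (levelSet_eq_union f x s) n
    · -- Here `δ = 0`, so exactness means that `fromShifts` is surjective in degree `i + 1 ≤ 0`.
      intro c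
      refine iff_of_true rfl (fromShifts_surjective k f s x (Int.negSucc n + 1) ?_ c)
      lia
  comm i s s' h := by
    ext x : 2
    refine (mvConnecting_naturality k (levelSet_eq_inter f x s) (levelSet_eq_union f x s)
      (levelSet_eq_inter f x s') (levelSet_eq_union f x s') (𝟙 _)
      (inclusion (levelSet_mono f (DeltaPlus.add_mono le_rfl ⟨h.1, le_rfl⟩)))
      (inclusion (levelSet_mono f (DeltaPlus.add_mono le_rfl ⟨le_rfl, h.2⟩)))
      (inclusion (levelSet_mono f (DeltaPlus.add_mono le_rfl h))) rfl rfl rfl rfl i).trans ?_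
    rw [CategoryTheory.Functor.map_id, Category.comp_id]
    rfl

lemma isMVHom_levelSet {f g : TopOverReal.{w}} (φ : f ⟶ g) :
    IsMVHom (levelSetδ.{u, w} k f) (levelSetδ.{u, w} k g) (levelSetModuleMap.{u, w} k φ) := by
  intro i s
  ext x : 2
  exact mvConnecting_naturality k (levelSet_eq_inter f x s) (levelSet_eq_union f x s)
    (levelSet_eq_inter g x s) (levelSet_eq_union g x s) ((levelSpaceMap φ).app x)
    ((levelSpaceMap φ).app _) ((levelSpaceMap φ).app _) ((levelSpaceMap φ).app _) rfl rfl rfl rfl i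

/-- The functor `f ↦ M^f` from spaces over `ℝ` to Mayer-Vietoris systems. -/
def levelSetFunctor : TopOverReal.{w} ⥤ MVSystem.{u, max u w} k where
  obj f := ⟨levelSetModule.{u, w} k f, levelSetδ k f, isMVSystem_levelSet k f⟩
  map φ := ⟨levelSetModuleMap.{u, w} k φ, isMVHom_levelSet k φ⟩
  map_id f := MVSystem.Hom.ext <| funext fun i => NatTrans.ext <| funext fun x =>
    (singularH.{u, w} k i).map_id _
  map_comp φ ψ := MVSystem.Hom.ext <| funext fun i => NatTrans.ext <| funext fun x =>
    (singularH.{u, w} k i).map_comp ((levelSpaceMap φ).app x) ((levelSpaceMap ψ).app x)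

end LevelSets

end

end MayerVietoris

theorem propositionP (k : Type u) [Field k] :
    -- the Mayer-Vietoris connecting homomorphisms of the covers are well defined
    (∀ (f : MayerVietoris.TopOverReal.{w}) (s : MayerVietoris.PosVec)
        (x : MayerVietoris.DeltaPlus),
      QuasiIso (MayerVietoris.levelSetSmallChainsMap.{u, w} k f s x)) ∧
    -- they form morphisms of persistence modules `δ f i s : M_{i+1}^f[s] ⟶ M_i^f`
    ∃ (δ : ∀ (f : MayerVietoris.TopOverReal.{w}) (i : ℤ) (s : MayerVietoris.PosVec),
        MayerVietoris.shift s.1 (MayerVietoris.levelSetModule.{u, w} k f (i + 1)) ⟶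
          MayerVietoris.levelSetModule.{u, w} k f i)
      (_ : ∀ (f : MayerVietoris.TopOverReal.{w}) (i : ℤ) (s : MayerVietoris.PosVec)
        (x : MayerVietoris.DeltaPlus),
        (δ f i s).app x = MayerVietoris.levelSetConnecting.{u, w} k f i s x)
      -- which make `M^f` a Mayer-Vietoris system
      (hMV : ∀ f : MayerVietoris.TopOverReal.{w},
        MayerVietoris.IsMVSystem (MayerVietoris.levelSetModule.{u, w} k f) (δ f))
      -- `φ_*` is a morphism of Mayer-Vietoris systems
      (hHom : ∀ {f g : MayerVietoris.TopOverReal.{w}} (φ : f ⟶ g),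
        MayerVietoris.IsMVHom (δ f) (δ g) (MayerVietoris.levelSetModuleMap.{u, w} k φ)),
      -- and `f ↦ M^f`, `φ ↦ φ_*` is a functor
      ∃ M : MayerVietoris.TopOverReal.{w} ⥤ MayerVietoris.MVSystem.{u, max u w} k,
        M.toPrefunctor =
          { obj := fun f => ⟨MayerVietoris.levelSetModule.{u, w} k f, δ f, hMV f⟩
            map := fun φ => ⟨MayerVietoris.levelSetModuleMap.{u, w} k φ, hHom φ⟩ } := by
  exact ⟨fun _ _ _ => inferInstance, MayerVietoris.levelSetδ k, fun _ _ _ _ => rfl,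
    MayerVietoris.isMVSystem_levelSet k, MayerVietoris.isMVHom_levelSet k,
    MayerVietoris.levelSetFunctor k, rfl⟩
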